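/- Let $N\ge 1$ be an integer, $s\in(0,1)$ with $N>2s$, $2_s^*:=\frac{2N}{N-2s}$, and $\epsilon\in(0,2_s^*-2)$. Let $V:\mathbb{R}^N\to\mathbb{R}$ satisfy $(V_1)$ $V\in C^2(\mathbb{R}^N)$ and there is a constant $V_0>0$ such that $$0<V_0\le V(x)\le V_\infty:=\sup_{x\in\mathbb{R}^N}V(x)=\liminf_{|x|\to+\infty}V(x)<+\infty .$$ Let $H^s_V(\mathbb{R}^N)$ be the space of real-valued functions $$H^s_V(\mathbb{R}^N):=\Big\{u\in L^2(\mathbb{R}^N,V(x)\,dx):\ [u]_s^2:=\iint_{\mathbb{R}^N\times\mathbb{R}^N}\frac{|u(x)-u(y)|^2}{|x-y|^{N+2s}}\,dx\,dy<\infty\Big\},$$ $$\|u\|_{s,V}:=\Big([u]_s^2+\int_{\mathbb{R}^N}V(x)u^2\,dx\Big)^{1/2},$$ and let $$S^V_{2_s^*-\epsilon}:=\inf\big\{\|u\|_{s,V}^2:\ u\in H^s_V(\mathbb{R}^N),\ \|u\|_{L^{2_s^*-\epsilon}(\mathbb{R}^N)}=1\big\}.$$ Then $S^V_{2_s^*-\epsilon}$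 is attained: there is $w_\epsilon\in H^s_V(\mathbb{R}^N)$ with $\|w_\epsilon\|_{L^{2_s^*-\epsilon}(\mathbb{R}^N)}=1$ and $\|w_\epsilon\|_{s,V}^2=S^V_{2_s^*-\epsilon}$. -/

import Mathlib

open MeasureTheory Filter
open scoped ENNReal

noncomputable section

namespace FracSchrodinger

/-- The fractional critical Sobolev exponent `2N / (N - 2s)`. -/
def critExp (N : ℕ) (s : ℝ) : ℝ := 2 * (N : ℝ) / ((N : ℝ) - 2 * s)

/-- Condition (V1) on the potential: `V` is of class `C²`, it is bounded below by a positive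
constant, bounded above, and its supremum equals its lower limit at infinity. -/
structure ConditionV1 {N : ℕ} (V : EuclideanSpace ℝ (Fin N) → ℝ) : Prop where
  contDiff : ContDiff ℝ 2 V
  lower : ∃ V₀ : ℝ, 0 < V₀ ∧ ∀ x, V₀ ≤ V x
  bddAbove : BddAbove (Set.range V)
  sup_eq_liminf : (⨆ x, V x) = liminf V (cocompact (EuclideanSpace ℝ (Fin N)))

/-- The squared Gagliardo seminorm
`[u]ₛ² = ∬ |u(x) - u(y)|² / |x - y|^(N + 2s) dx dy`, with values in `[0, ∞]`. -/
def gagliardoSq {N : ℕ} (s : ℝ) (u : EuclideanSpace ℝ (Fin N) → ℝ) : ℝ≥0∞ :=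
  ∫⁻ z : EuclideanSpace ℝ (Fin N) × EuclideanSpace ℝ (Fin N),
    ENNReal.ofReal (|u z.1 - u z.2| ^ 2 / ‖z.1 - z.2‖ ^ ((N : ℝ) + 2 * s))

/-- The space `H^s_V(ℝ^N)`: functions in `L²(ℝ^N, V(x) dx)` with finite Gagliardo seminorm
(as functions, not as classes modulo equality almost everywhere). -/
def HsV {N : ℕ} (s : ℝ) (V : EuclideanSpace ℝ (Fin N) → ℝ) :
    Set (EuclideanSpace ℝ (Fin N) → ℝ) :=
  {u | MemLp u 2 (volume.withDensity fun x => ENNReal.ofReal (V x)) ∧ gagliardoSq s u < ∞}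

/-- The norm `‖u‖_{s,V} = ([u]ₛ² + ∫ V u² dx)^(1/2)` on `H^s_V(ℝ^N)`. -/
def normHsV {N : ℕ} (s : ℝ) (V u : EuclideanSpace ℝ (Fin N) → ℝ) : ℝ :=
  Real.sqrt ((gagliardoSq s u).toReal + ∫ x, V x * u x ^ 2)

/-- The constraint set: functions in `H^s_V(ℝ^N)` whose `L^p(ℝ^N, dx)` norm is `1`. -/
def unitSphere {N : ℕ} (s p : ℝ) (V : EuclideanSpace ℝ (Fin N) → ℝ) :
    Set (EuclideanSpace ℝ (Fin N) → ℝ) :=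
  {u | u ∈ HsV s V ∧ eLpNorm u (ENNReal.ofReal p) volume = 1}

/-- The constrained infimum `S^V_p = inf {‖u‖_{s,V}² : u ∈ H^s_V(ℝ^N), ‖u‖_p = 1}`. -/
def infLevel {N : ℕ} (s p : ℝ) (V : EuclideanSpace ℝ (Fin N) → ℝ) : ℝ :=
  sInf ((fun u => normHsV s V u ^ 2) '' unitSphere s p V)

end FracSchrodinger

end

noncomputable section

namespace FracSchrodinger

open Metric Topology

variable {N : ℕ}

local notation "𝔼" => EuclideanSpace ℝ (Fin N)

/-! The proof is concentration-compactness for a minimizing sequence, with ball averages replacing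
the Sobolev and Rellich theorems. Write `p` for the subcritical exponent and `S` for the infimum.

Vanishing is excluded by `exists_le_abs_ballAvg`. Because `N (1 - 2/p) < 2s`, the difference between
`u` and its average over balls of radius `r` tends to zero in `L^p` as `r → 0` along powers of
`1/2`, uniformly on sets of bounded seminorm (`abs_sub_ballAvg_le`). A function with bounded energy
and unit `L^p` norm therefore has an average of size at least `δ` on some ball of fixed radius.
Translating these balls to the origin gives a sequence `v n`, minimizing for the translated
potentials `V (· + y n)`.

A subsequence of `v n` converges almost everywhere to some `w` (`exists_subseq_tendsto_ae`), and `w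
≠ 0` because the averages at the origin stay away from zero.

Dichotomy is excluded by `lintegral_rpow_eq_one_of_minimizing`. The Brezis–Lieb splitting applies to
the energy and to the `L^p` integral. With `a = ∫ |w|^p` and `β` a limit point of `∫ |v n - w|^p`,
it gives `a^(2/p) + β^(2/p) ≤ 1 ≤ a + β`. Since `2/p < 1` and `a ≠ 0`, this forces `a = 1`.

It remains to undo the translations (`exists_translate_energy_le`). If `y n` has a bounded
subsequence, a translate of `w` has energy at most `S` for `V`. If `y n` escapes to infinity, `w`
has energy at most `S` for the constant potential `sup V`, hence also for the smaller `V`. -/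

/-! ### Ball averages controlled by the Gagliardo seminorm -/

theorem enorm_sub_integral_sq_le {α : Type*} [MeasurableSpace α] {ν : Measure α}
    [IsProbabilityMeasure ν] {u : α → ℝ} (hu : Integrable u ν) (c : ℝ) :
    ‖c - ∫ y, u y ∂ν‖ₑ ^ 2 ≤ ∫⁻ y, ‖c - u y‖ₑ ^ 2 ∂ν := by
  have h1 : c - ∫ y, u y ∂ν = ∫ y, (c - u y) ∂ν := by
    rw [integral_sub (integrable_const c) hu]; simp
  have h2 : AEStronglyMeasurable (fun y => c - u y) ν :=
    aestronglyMeasurable_const.sub hu.aestronglyMeasurable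
  have h3 := eLpNorm_le_eLpNorm_of_exponent_le (p := 1) (q := 2) (by norm_num) h2
  have h4 : ‖c - ∫ y, u y ∂ν‖ₑ ≤ eLpNorm (fun y => c - u y) 2 ν := by
    rw [h1]
    refine (enorm_integral_le_lintegral_enorm _).trans ?_
    rwa [eLpNorm_one_eq_lintegral_enorm] at h3
  calc ‖c - ∫ y, u y ∂ν‖ₑ ^ 2 ≤ eLpNorm (fun y => c - u y) 2 ν ^ 2 := by gcongr
    _ = ∫⁻ y, ‖c - u y‖ₑ ^ 2 ∂ν := by
      rw [eLpNorm_eq_lintegral_rpow_enorm_toReal (by norm_num) (by norm_num),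
        ← ENNReal.rpow_natCast, ← ENNReal.rpow_mul]
      simp

theorem enorm_sub_setAverage_sq_le {α : Type*} [MeasurableSpace α] {μ : Measure α} {B : Set α}
    (h0 : μ B ≠ 0) (h1 : μ B ≠ ∞) {u : α → ℝ} (hu : IntegrableOn u B μ) (c : ℝ) :
    ‖c - ⨍ y in B, u y ∂μ‖ₑ ^ 2 ≤ (μ B)⁻¹ * ∫⁻ y in B, ‖c - u y‖ₑ ^ 2 ∂μ := by
  have : IsProbabilityMeasure ((μ B)⁻¹ • μ.restrict B) :=
    ⟨by simp [ENNReal.inv_mul_cancel h0 h1]⟩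
  have h := enorm_sub_integral_sq_le (ν := (μ B)⁻¹ • μ.restrict B)
    (hu.smul_measure (ENNReal.inv_ne_top.2 h0)) c
  rw [lintegral_smul_measure] at h
  rw [average_eq', Measure.restrict_apply_univ]
  exact h

/-- The density `∫ |u(x) - u(y)|² / |x - y|^(N + 2s) dy` of the Gagliardo seminorm at `x`. -/
def gagliardoDensity (s : ℝ) (u : EuclideanSpace ℝ (Fin N) → ℝ)
    (x : EuclideanSpace ℝ (Fin N)) : ℝ≥0∞ :=
  ∫⁻ y, ENNReal.ofReal (|u x - u y| ^ 2 / ‖x - y‖ ^ ((N : ℝ) + 2 * s))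

/-- The average of `u` over the ball of radius `r` about `x`. -/
def ballAvg (r : ℝ) (u : EuclideanSpace ℝ (Fin N) → ℝ) (x : EuclideanSpace ℝ (Fin N)) : ℝ :=
  ⨍ y in ball x r, u y

theorem aemeasurable_gagliardo_integrand (s : ℝ) {u : 𝔼 → ℝ} (hu : AEMeasurable u) :
    AEMeasurable (fun z : 𝔼 × 𝔼 =>
      ENNReal.ofReal (|u z.1 - u z.2| ^ 2 / ‖z.1 - z.2‖ ^ ((N : ℝ) + 2 * s))) := by
  have h1 : AEMeasurable (fun z : 𝔼 × 𝔼 => u z.1) (volume.prod volume) :=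
    hu.comp_quasiMeasurePreserving Measure.quasiMeasurePreserving_fst
  have h2 : AEMeasurable (fun z : 𝔼 × 𝔼 => u z.2) (volume.prod volume) :=
    hu.comp_quasiMeasurePreserving Measure.quasiMeasurePreserving_snd
  have h3 : Measurable (fun z : 𝔼 × 𝔼 => ‖z.1 - z.2‖ ^ ((N : ℝ) + 2 * s)) := by fun_prop
  have h4 : AEMeasurable (fun z : 𝔼 × 𝔼 => |u z.1 - u z.2|) (volume.prod volume) :=
    (h1.sub h2).norm
  exact ((h4.pow_const 2).div h3.aemeasurable).ennreal_ofReal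

theorem gagliardoSq_eq_lintegral (s : ℝ) {u : 𝔼 → ℝ} (hu : AEMeasurable u) :
    gagliardoSq s u = ∫⁻ x, gagliardoDensity s u x :=
  lintegral_prod _ (aemeasurable_gagliardo_integrand s hu)

theorem aemeasurable_gagliardoDensity (s : ℝ) {u : 𝔼 → ℝ} (hu : AEMeasurable u) :
    AEMeasurable (gagliardoDensity s u) :=
  (aemeasurable_gagliardo_integrand s hu).lintegral_prod_right'

/-- On pairs at distance at most `R` the kernel is at least `R^(-N-2s)`. This turns unweighted
differences into seminorm terms. -/
theorem enorm_sub_sq_le_kernel {s R : ℝ} (hs : 0 ≤ s) (u : 𝔼 → ℝ) {x y : 𝔼}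
    (hR : ‖x - y‖ ≤ R) :
    ‖u x - u y‖ₑ ^ 2 ≤ ENNReal.ofReal (R ^ ((N : ℝ) + 2 * s)) *
      ENNReal.ofReal (|u x - u y| ^ 2 / ‖x - y‖ ^ ((N : ℝ) + 2 * s)) := by
  rcases eq_or_ne x y with rfl | hxy
  · simp
  have hpos : 0 < ‖x - y‖ := norm_pos_iff.2 (sub_ne_zero.2 hxy)
  have hR0 : 0 ≤ R := hpos.le.trans hR
  have he : 0 ≤ (N : ℝ) + 2 * s := by positivity
  rw [← ENNReal.ofReal_mul (by positivity), ← ofReal_norm,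
    ← ENNReal.ofReal_pow (norm_nonneg _), Real.norm_eq_abs]
  refine ENNReal.ofReal_le_ofReal ?_
  rw [mul_div_assoc', le_div_iff₀ (by positivity), mul_comm]
  gcongr

theorem lintegral_ball_enorm_sub_sq_le {s R : ℝ} (hs : 0 ≤ s) (u : 𝔼 → ℝ) {x : 𝔼} {B : Set 𝔼}
    (hB : MeasurableSet B) (hR : ∀ y ∈ B, ‖x - y‖ ≤ R) :
    ∫⁻ y in B, ‖u x - u y‖ₑ ^ 2 ≤
      ENNReal.ofReal (R ^ ((N : ℝ) + 2 * s)) * gagliardoDensity s u x := by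
  calc ∫⁻ y in B, ‖u x - u y‖ₑ ^ 2
      ≤ ∫⁻ y in B, ENNReal.ofReal (R ^ ((N : ℝ) + 2 * s)) *
        ENNReal.ofReal (|u x - u y| ^ 2 / ‖x - y‖ ^ ((N : ℝ) + 2 * s)) :=
        setLIntegral_mono' hB fun y hy => enorm_sub_sq_le_kernel hs u (hR y hy)
    _ ≤ ∫⁻ y, ENNReal.ofReal (R ^ ((N : ℝ) + 2 * s)) *
        ENNReal.ofReal (|u x - u y| ^ 2 / ‖x - y‖ ^ ((N : ℝ) + 2 * s)) :=
        setLIntegral_le_lintegral _ _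
    _ = _ := lintegral_const_mul' _ _ ENNReal.ofReal_ne_top

theorem volume_ball_inv (x : 𝔼) {r : ℝ} (hr : 0 < r) :
    (volume (ball x r))⁻¹ = ENNReal.ofReal ((r ^ N)⁻¹) * (volume (ball (0 : 𝔼) 1))⁻¹ := by
  rw [Measure.addHaar_ball_of_pos _ _ hr, finrank_euclideanSpace_fin,
    ENNReal.mul_inv (Or.inr measure_ball_lt_top.ne) (Or.inl ENNReal.ofReal_ne_top),
    ENNReal.ofReal_inv_of_pos (by positivity)]

theorem integrableOn_ball_of_memLp {u : 𝔼 → ℝ} (hu : MemLp u 2) (x : 𝔼) (r : ℝ) :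
    IntegrableOn u (ball x r) := by
  have : IsFiniteMeasure (volume.restrict (ball x r)) := ⟨by simp [measure_ball_lt_top]⟩
  exact (hu.restrict _).integrable (by norm_num)

theorem enorm_sub_ballAvg_sq_le {s r : ℝ} (hs : 0 ≤ s) (hr : 0 < r) {u : 𝔼 → ℝ} (hu : MemLp u 2)
    (x : 𝔼) :
    ‖u x - ballAvg r u x‖ₑ ^ 2 ≤
      (volume (ball (0 : 𝔼) 1))⁻¹ * ENNReal.ofReal (r ^ (2 * s)) * gagliardoDensity s u x := by
  have h := enorm_sub_setAverage_sq_le (measure_ball_pos volume x hr).ne' measure_ball_lt_top.ne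
    (integrableOn_ball_of_memLp hu x r) (u x)
  refine h.trans ?_
  have h2 := lintegral_ball_enorm_sub_sq_le hs u (x := x) (R := r) measurableSet_ball
    (fun y hy => by rw [← dist_eq_norm, dist_comm]; exact (mem_ball.1 hy).le)
  refine (mul_le_mul_right h2 _).trans (le_of_eq ?_)
  rw [volume_ball_inv x hr]
  have h3 : ENNReal.ofReal (r ^ (2 * s)) =
      ENNReal.ofReal ((r ^ N)⁻¹) * ENNReal.ofReal (r ^ ((N : ℝ) + 2 * s)) := by
    rw [← ENNReal.ofReal_mul (by positivity), Real.rpow_add hr, Real.rpow_natCast]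
    congr 1
    field_simp
  rw [h3]
  ring

/-- Jensen is applied in both balls, and two points of the concentric balls are less than `2r`
apart. The power `r^(2s - N)` comes with the global seminorm, so the bound is uniform in `x`, unlike
`enorm_sub_ballAvg_sq_le`, which has the better power but the density at `x`. -/
theorem enorm_ballAvg_sub_ballAvg_sq_le {s r : ℝ} (hs : 0 ≤ s) (hr : 0 < r) {u : 𝔼 → ℝ}
    (hu : MemLp u 2) (x : 𝔼) :
    ‖ballAvg r u x - ballAvg (r / 2) u x‖ₑ ^ 2 ≤
      (volume (ball (0 : 𝔼) 1))⁻¹ ^ 2 *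
        ENNReal.ofReal (2 ^ N * 2 ^ ((N : ℝ) + 2 * s) * r ^ (2 * s - N)) * gagliardoSq s u := by
  have hr2 : 0 < r / 2 := by positivity
  have h := enorm_sub_setAverage_sq_le (measure_ball_pos volume x hr2).ne'
    measure_ball_lt_top.ne (integrableOn_ball_of_memLp hu x (r / 2)) (ballAvg r u x)
  refine h.trans ?_
  have h2 : ∀ y ∈ ball x (r / 2), ‖ballAvg r u x - u y‖ₑ ^ 2 ≤
      (volume (ball x r))⁻¹ * (ENNReal.ofReal ((2 * r) ^ ((N : ℝ) + 2 * s)) *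
        gagliardoDensity s u y) := by
    intro y hy
    rw [← enorm_neg, neg_sub]
    refine (enorm_sub_setAverage_sq_le (measure_ball_pos volume x hr).ne'
      measure_ball_lt_top.ne (integrableOn_ball_of_memLp hu x r) (u y)).trans ?_
    refine mul_le_mul_right (lintegral_ball_enorm_sub_sq_le hs u measurableSet_ball ?_) _
    intro z hz
    rw [← dist_eq_norm]
    have := dist_triangle y x z
    have h3 := mem_ball.1 hy
    have h4 := mem_ball'.1 hz
    linarith
  have h3 : ∫⁻ y in ball x (r / 2), ‖ballAvg r u x - u y‖ₑ ^ 2 ≤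
      (volume (ball x r))⁻¹ * (ENNReal.ofReal ((2 * r) ^ ((N : ℝ) + 2 * s)) *
        gagliardoSq s u) := by
    refine (setLIntegral_mono' measurableSet_ball h2).trans ?_
    refine (setLIntegral_le_lintegral _ _).trans ?_
    rw [lintegral_const_mul' _ _ (ENNReal.inv_ne_top.2 (measure_ball_pos volume x hr).ne'),
      lintegral_const_mul' _ _ ENNReal.ofReal_ne_top,
      gagliardoSq_eq_lintegral s hu.aestronglyMeasurable.aemeasurable]
  refine (mul_le_mul_right h3 _).trans (le_of_eq ?_)
  rw [volume_ball_inv x hr, volume_ball_inv x hr2]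
  have h5 : ENNReal.ofReal (2 ^ N * 2 ^ ((N : ℝ) + 2 * s) * r ^ (2 * s - N)) =
      ENNReal.ofReal (((r / 2) ^ N)⁻¹) * ENNReal.ofReal ((r ^ N)⁻¹) *
        ENNReal.ofReal ((2 * r) ^ ((N : ℝ) + 2 * s)) := by
    rw [← ENNReal.ofReal_mul (by positivity), ← ENNReal.ofReal_mul (by positivity),
      Real.mul_rpow (by norm_num) hr.le, Real.rpow_add hr, Real.rpow_natCast, Real.rpow_sub hr,
      Real.rpow_natCast]
    congr 1
    field_simp
    rw [← mul_pow]
    congr 1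
    ring
  rw [h5]
  ring

theorem ballAvg_congr {u v : 𝔼 → ℝ} (h : u =ᵐ[volume] v) (r : ℝ) : ballAvg r u = ballAvg r v := by
  funext x
  exact average_congr (ae_restrict_of_ae h)

/-- All balls of radius `r` have the same volume, so the average is a constant times a parametric
integral over the measurable set `dist y x < r`. -/
theorem measurable_ballAvg (r : ℝ) {u : 𝔼 → ℝ} (hu : AEStronglyMeasurable u) :
    Measurable (ballAvg r u) := by
  obtain ⟨v, hv, huv⟩ := hu
  rw [ballAvg_congr huv]
  have h1 : ballAvg r v = fun x => (volume.real (ball (0 : 𝔼) r))⁻¹ *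
      ∫ y, {z : 𝔼 × 𝔼 | dist z.2 z.1 < r}.indicator (fun z => v z.2) (x, y) := by
    funext x
    rw [ballAvg, setAverage_eq, smul_eq_mul, ← integral_indicator measurableSet_ball]
    congr 2
    rw [measureReal_def, measureReal_def, Measure.addHaar_ball_center]
  rw [h1]
  refine Measurable.const_mul ?_ _
  refine (StronglyMeasurable.integral_prod_right' (f := {z : 𝔼 × 𝔼 | dist z.2 z.1 < r}.indicator
    (fun z => v z.2)) ?_).measurable
  refine (hv.comp_measurable measurable_snd).indicator ?_
  exact measurableSet_lt (by fun_prop) measurable_const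

theorem enorm_ballAvg_sq_le {r : ℝ} (hr : 0 < r) {u : 𝔼 → ℝ} (hu : MemLp u 2) (x : 𝔼) :
    ‖ballAvg r u x‖ₑ ^ 2 ≤ (volume (ball (0 : 𝔼) r))⁻¹ * ∫⁻ y, ‖u y‖ₑ ^ 2 := by
  have h := enorm_sub_setAverage_sq_le (measure_ball_pos volume x hr).ne' measure_ball_lt_top.ne
    (integrableOn_ball_of_memLp hu x r) 0
  simp only [zero_sub, enorm_neg] at h
  refine h.trans ?_
  rw [Measure.addHaar_ball_center]
  exact mul_le_mul_right (setLIntegral_le_lintegral _ _) _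

theorem lintegral_enorm_sub_ballAvg_sq_le {s r : ℝ} (hs : 0 ≤ s) (hr : 0 < r) {u : 𝔼 → ℝ}
    (hu : MemLp u 2) :
    ∫⁻ x, ‖u x - ballAvg r u x‖ₑ ^ 2 ≤
      (volume (ball (0 : 𝔼) 1))⁻¹ * ENNReal.ofReal (r ^ (2 * s)) * gagliardoSq s u := by
  refine (lintegral_mono fun x => enorm_sub_ballAvg_sq_le hs hr hu x).trans (le_of_eq ?_)
  rw [lintegral_const_mul' _ _ (ENNReal.mul_ne_top
      (ENNReal.inv_ne_top.2 (measure_ball_pos volume _ one_pos).ne') ENNReal.ofReal_ne_top),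
    gagliardoSq_eq_lintegral s hu.aestronglyMeasurable.aemeasurable]

/-! ### Uniform approximation in `L^p` by ball averages -/

theorem le_rpow_mul_rpow_of_le {a A B θ : ℝ} (ha : 0 ≤ a) (hA : a ≤ A) (hB : a ≤ B)
    (h0 : 0 ≤ θ) (h1 : θ ≤ 1) : a ≤ A ^ θ * B ^ (1 - θ) := by
  have h : a = a ^ θ * a ^ (1 - θ) := by
    rw [← Real.rpow_add_of_nonneg ha h0 (by linarith)]
    simp
  calc a = a ^ θ * a ^ (1 - θ) := h
    _ ≤ A ^ θ * B ^ (1 - θ) := by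
      have hA0 := ha.trans hA
      have h1' : 0 ≤ 1 - θ := by linarith
      gcongr

theorem sq_le_of_enorm_sq_le {a b : ℝ} {G : ℝ≥0∞} (hG : G ≠ ∞) (hb : 0 ≤ b)
    {C : ℝ≥0∞} (hC : C ≠ ∞) (h : ‖a‖ₑ ^ 2 ≤ C * ENNReal.ofReal b * G) :
    a ^ 2 ≤ C.toReal * b * G.toReal := by
  have h2 := ENNReal.toReal_mono
    (ENNReal.mul_ne_top (ENNReal.mul_ne_top hC ENNReal.ofReal_ne_top) hG) h
  rw [ENNReal.toReal_mul, ENNReal.toReal_mul, ENNReal.toReal_ofReal hb, ENNReal.toReal_pow,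
    toReal_enorm, Real.norm_eq_abs, sq_abs] at h2
  exact h2

/-- Telescope over dyadic radii. Each increment has a pointwise bound through the density at `x` and
a uniform bound through the seminorm. Interpolating them leaves a positive power of the radius
exactly in the subcritical range, so the series is geometric. The density enters to the power `1/p`,
so that the `p`-th power of the estimate can be integrated in `x`. -/
theorem abs_sub_ballAvg_le {s p : ℝ} (hs : 0 < s) (hp : 2 < p)
    (hps : (N : ℝ) * (1 - 2 / p) < 2 * s) :
    ∃ K ρ : ℝ, 0 ≤ K ∧ 0 ≤ ρ ∧ ρ < 1 ∧ ∀ (u : 𝔼 → ℝ) (x : 𝔼) (k : ℕ), MemLp u 2 → gagliardoSq s u ≠ ∞ →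
      gagliardoDensity s u x ≠ ∞ →
      |u x - ballAvg ((1 / 2) ^ k) u x| ≤ K * ρ ^ k *
        ((gagliardoDensity s u x).toReal ^ (1 / p) *
          (gagliardoSq s u).toReal ^ (1 / 2 - 1 / p)) := by
  set c : ℝ≥0∞ := (volume (ball (0 : 𝔼) 1))⁻¹ with hc
  have hcf : c ≠ ∞ := ENNReal.inv_ne_top.2 (measure_ball_pos volume _ one_pos).ne'
  have hcf2 : c ^ 2 ≠ ∞ := ENNReal.pow_ne_top hcf
  -- Weights `2/p` and `1 - 2/p` on the exponents `2s` and `2s - N` add up to `2δ`.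
  set δ : ℝ := s - (N : ℝ) * (1 / 2 - 1 / p) with hδ
  have hδ0 : 0 < δ := by
    have : (N : ℝ) * (1 - 2 / p) = 2 * ((N : ℝ) * (1 / 2 - 1 / p)) := by ring
    rw [hδ]; linarith
  set ρ : ℝ := (1 / 2) ^ δ with hρ
  have hρ0 : 0 ≤ ρ := by positivity
  have hρ1 : ρ < 1 := Real.rpow_lt_one (by norm_num) (by norm_num) hδ0
  set A : ℝ := 4 * c.toReal with hA
  set B : ℝ := (c ^ 2).toReal * (2 ^ N * 2 ^ ((N : ℝ) + 2 * s)) with hB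
  have hA0 : 0 ≤ A := by positivity
  have hB0 : 0 ≤ B := by positivity
  have h1ρ : 0 < 1 - ρ := by linarith
  refine ⟨A ^ (1 / p) * B ^ (1 / 2 - 1 / p) / (1 - ρ), ρ, by positivity, hρ0, hρ1, ?_⟩
  intro u x k hu hg hG
  set G := (gagliardoDensity s u x).toReal with hGdef
  set g := (gagliardoSq s u).toReal with hgdef
  have hG0 : 0 ≤ G := ENNReal.toReal_nonneg
  have hg0 : 0 ≤ g := ENNReal.toReal_nonneg
  set a : ℕ → ℝ := fun j => ballAvg ((1 / 2) ^ j) u x with ha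
  have hpj : ∀ j : ℕ, (0 : ℝ) < (1 / 2) ^ j := fun j => by positivity
  have e1 : ∀ j, (u x - a j) ^ 2 ≤ c.toReal * ((1 / 2) ^ j) ^ (2 * s) * G := fun j =>
    sq_le_of_enorm_sq_le hG (by positivity) hcf (enorm_sub_ballAvg_sq_le hs.le (hpj j) hu x)
  have e2 : ∀ j, (a j - a (j + 1)) ^ 2 ≤ B * ((1 / 2) ^ j) ^ (2 * s - N) * g := fun j => by
    have := sq_le_of_enorm_sq_le hg (by positivity) hcf2
      (enorm_ballAvg_sub_ballAvg_sq_le hs.le (hpj j) hu x)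
    have h3 : (1 / 2 : ℝ) ^ j / 2 = (1 / 2) ^ (j + 1) := by rw [pow_succ]; ring
    rw [h3] at this
    refine this.trans (le_of_eq ?_)
    rw [hB]; ring
  have e3 : ∀ j, (a j - a (j + 1)) ^ 2 ≤ A * ((1 / 2) ^ j) ^ (2 * s) * G := fun j => by
    have i1 := e1 j
    have i2 := e1 (j + 1)
    have i3 : ((1 / 2 : ℝ) ^ (j + 1)) ^ (2 * s) ≤ ((1 / 2) ^ j) ^ (2 * s) := by
      refine Real.rpow_le_rpow (by positivity) ?_ (by positivity)
      exact pow_le_pow_of_le_one (by norm_num) (by norm_num) (Nat.le_succ j)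
    have i4 : c.toReal * ((1 / 2) ^ (j + 1)) ^ (2 * s) * G ≤
        c.toReal * ((1 / 2) ^ j) ^ (2 * s) * G := by gcongr
    rw [hA]
    -- This is `(α - β)² ≤ 2α² + 2β²`, whence the factor `4` in `A`.
    nlinarith [sq_nonneg ((u x - a j) + (u x - a (j + 1)))]
  have e4 : ∀ j, dist (a j) (a (j + 1)) ≤
      (A ^ (1 / p) * B ^ (1 / 2 - 1 / p) * (G ^ (1 / p) * g ^ (1 / 2 - 1 / p))) * ρ ^ j := by
    intro j
    have hpp : 0 < p := by linarith
    have h2p : 2 / p ≤ 1 := by rw [div_le_one hpp]; exact hp.le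
    have h12 : 0 ≤ 1 / 2 - 1 / p := by
      have : 2 / p = 2 * (1 / p) := by ring
      linarith
    have i := le_rpow_mul_rpow_of_le (sq_nonneg _) (e3 j) (e2 j) (θ := 2 / p) (by positivity) h2p
    rw [Real.dist_eq, ← Real.sqrt_sq_eq_abs]
    refine Real.sqrt_le_iff.2 ⟨by positivity, i.trans (le_of_eq ?_)⟩
    rw [Real.mul_rpow (by positivity) hG0, Real.mul_rpow hA0 (by positivity),
      Real.mul_rpow (by positivity) hg0, Real.mul_rpow hB0 (by positivity)]
    have t1 : ∀ y : ℝ, 0 ≤ y → y ^ (2 / p) = (y ^ (1 / p)) ^ 2 := fun y hy => by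
      rw [← Real.rpow_natCast, ← Real.rpow_mul hy]; congr 1; push_cast; ring
    have t2 : ∀ y : ℝ, 0 ≤ y → y ^ (1 - 2 / p) = (y ^ (1 / 2 - 1 / p)) ^ 2 := fun y hy => by
      rw [← Real.rpow_natCast, ← Real.rpow_mul hy]; congr 1; push_cast; ring
    have t3 : (((1 / 2 : ℝ) ^ j) ^ (2 * s)) ^ (2 / p) *
        (((1 / 2 : ℝ) ^ j) ^ (2 * s - N)) ^ (1 - 2 / p) = (ρ ^ j) ^ 2 := by
      have hh : (0 : ℝ) ≤ 1 / 2 := by norm_num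
      have i1 : (ρ ^ j) ^ 2 = ((1 / 2 : ℝ) ^ j) ^ (2 * δ) := by
        rw [hρ, ← Real.rpow_natCast, ← Real.rpow_natCast, ← Real.rpow_natCast,
          ← Real.rpow_mul hh, ← Real.rpow_mul hh, ← Real.rpow_mul hh]
        congr 1
        push_cast; ring
      rw [i1, ← Real.rpow_mul (hpj j).le, ← Real.rpow_mul (hpj j).le, ← Real.rpow_add (hpj j)]
      congr 1
      rw [hδ]; ring
    rw [t1 A hA0, t1 G hG0, t2 B hB0, t2 g hg0]
    calc _ = (A ^ (1 / p)) ^ 2 * (B ^ (1 / 2 - 1 / p)) ^ 2 * ((G ^ (1 / p)) ^ 2 *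
          (g ^ (1 / 2 - 1 / p)) ^ 2) * ((((1 / 2 : ℝ) ^ j) ^ (2 * s)) ^ (2 / p) *
        (((1 / 2 : ℝ) ^ j) ^ (2 * s - N)) ^ (1 - 2 / p)) := by ring
      _ = _ := by rw [t3]; ring
  have e5 : Tendsto a atTop (𝓝 (u x)) := by
    rw [tendsto_iff_dist_tendsto_zero]
    have l1 : Tendsto (fun j : ℕ => c.toReal * ((1 / 2 : ℝ) ^ j) ^ (2 * s) * G) atTop (𝓝 0) := by
      have : Tendsto (fun j : ℕ => ((1 / 2 : ℝ) ^ j) ^ (2 * s)) atTop (𝓝 0) := by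
        have h0 : (0 : ℝ) = 0 ^ (2 * s) := (Real.zero_rpow (by positivity)).symm
        rw [h0]
        exact (tendsto_pow_atTop_nhds_zero_of_lt_one (by norm_num) (by norm_num)).rpow_const
          (Or.inr (by positivity))
      simpa using (this.const_mul c.toReal).mul_const G
    have l2 := l1.sqrt
    rw [Real.sqrt_zero] at l2
    refine squeeze_zero (fun _ => dist_nonneg) (fun j => ?_) l2
    rw [dist_comm, Real.dist_eq, ← Real.sqrt_sq_eq_abs]
    exact Real.sqrt_le_sqrt (e1 j)
  have e6 := dist_le_of_le_geometric_of_tendsto ρ _ hρ1 e4 e5 k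
  rw [dist_comm, Real.dist_eq] at e6
  refine e6.trans (le_of_eq ?_)
  field_simp

theorem exists_radius_lintegral_sub_ballAvg_le {s p : ℝ} (hs : 0 < s) (hp : 2 < p)
    (hps : (N : ℝ) * (1 - 2 / p) < 2 * s) (M : ℝ) {η : ℝ≥0∞} (hη : η ≠ 0) :
    ∃ r : ℝ, 0 < r ∧ ∀ u : 𝔼 → ℝ, MemLp u 2 → gagliardoSq s u ≤ ENNReal.ofReal M →
      ∫⁻ x, ‖u x - ballAvg r u x‖ₑ ^ p ≤ η := by
  obtain ⟨K, ρ, hK, hρ0, hρ1, H⟩ := abs_sub_ballAvg_le (N := N) hs hp hps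
  have hpp : 0 < p := by linarith
  set M' := max M 0 with hM'
  have l1 : Tendsto (fun k : ℕ => ENNReal.ofReal ((K * ρ ^ k) ^ p * M' ^ (p / 2 - 1) * M')) atTop
      (𝓝 0) := by
    have h1 : Tendsto (fun k : ℕ => K * ρ ^ k) atTop (𝓝 0) := by
      simpa using (tendsto_pow_atTop_nhds_zero_of_lt_one hρ0 hρ1).const_mul K
    have h2 := h1.rpow_const (p := p) (Or.inr hpp.le)
    rw [Real.zero_rpow hpp.ne'] at h2
    have h3 := ENNReal.tendsto_ofReal ((h2.mul_const (M' ^ (p / 2 - 1))).mul_const M')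
    simpa using h3
  obtain ⟨k, hk⟩ := (l1.eventually (ge_mem_nhds (pos_iff_ne_zero.2 hη))).exists
  refine ⟨(1 / 2) ^ k, by positivity, fun u hu hg => ?_⟩
  have hgf : gagliardoSq s u ≠ ∞ := ne_top_of_le_ne_top ENNReal.ofReal_ne_top hg
  have hum := hu.aestronglyMeasurable.aemeasurable
  have hGf : ∀ᵐ x, gagliardoDensity s u x < ∞ :=
    ae_lt_top' (aemeasurable_gagliardoDensity s hum)
      (by rwa [← gagliardoSq_eq_lintegral s hum])
  have hgM : (gagliardoSq s u).toReal ≤ M' := by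
    refine ENNReal.toReal_le_of_le_ofReal (le_max_right _ _) (hg.trans ?_)
    exact ENNReal.ofReal_le_ofReal (le_max_left _ _)
  have hptw : ∀ᵐ x, ‖u x - ballAvg ((1 / 2) ^ k) u x‖ₑ ^ p ≤
      ENNReal.ofReal ((K * ρ ^ k) ^ p * M' ^ (p / 2 - 1)) * gagliardoDensity s u x := by
    filter_upwards [hGf] with x hx
    have h1 := H u x k hu hgf hx.ne
    have h2 : |u x - ballAvg ((1 / 2) ^ k) u x| ^ p ≤
        ((K * ρ ^ k) ^ p * M' ^ (p / 2 - 1)) * (gagliardoDensity s u x).toReal := by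
      refine (Real.rpow_le_rpow (abs_nonneg _) h1 hpp.le).trans ?_
      have hG0 : 0 ≤ (gagliardoDensity s u x).toReal := ENNReal.toReal_nonneg
      have hg0 : 0 ≤ (gagliardoSq s u).toReal := ENNReal.toReal_nonneg
      rw [Real.mul_rpow (mul_nonneg hK (pow_nonneg hρ0 k)) (by positivity),
        Real.mul_rpow (Real.rpow_nonneg hG0 _) (Real.rpow_nonneg hg0 _), ← Real.rpow_mul hG0, ← Real.rpow_mul hg0, one_div,
        inv_mul_cancel₀ hpp.ne', Real.rpow_one]
      have h3 : (1 / 2 - p⁻¹) * p = p / 2 - 1 := by field_simp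
      rw [h3]
      have h4 : (gagliardoSq s u).toReal ^ (p / 2 - 1) ≤ M' ^ (p / 2 - 1) :=
        Real.rpow_le_rpow hg0 hgM (by linarith)
      calc _ ≤ (K * ρ ^ k) ^ p * ((gagliardoDensity s u x).toReal * M' ^ (p / 2 - 1)) := by gcongr
        _ = _ := by ring
    have h5 : ‖u x - ballAvg ((1 / 2) ^ k) u x‖ₑ ^ p =
        ENNReal.ofReal (|u x - ballAvg ((1 / 2) ^ k) u x| ^ p) := by
      rw [← ENNReal.ofReal_rpow_of_nonneg (abs_nonneg _) hpp.le, ← Real.norm_eq_abs,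
        ofReal_norm]
    rw [h5]
    refine (ENNReal.ofReal_le_ofReal h2).trans (le_of_eq ?_)
    rw [ENNReal.ofReal_mul (by positivity), ENNReal.ofReal_toReal hx.ne]
  refine (lintegral_mono_ae hptw).trans ?_
  rw [lintegral_const_mul' _ _ ENNReal.ofReal_ne_top, ← gagliardoSq_eq_lintegral s hum]
  refine le_trans ?_ hk
  rw [ENNReal.ofReal_mul (p := (K * ρ ^ k) ^ p * M' ^ (p / 2 - 1)) (by positivity)]
  refine mul_le_mul_right (hg.trans ?_) _
  exact ENNReal.ofReal_le_ofReal (le_max_left _ _)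

/-! ### Exclusion of vanishing -/

theorem sq_eLpNorm_two {α : Type*} [MeasurableSpace α] {μ : Measure α} (f : α → ℝ) :
    eLpNorm f 2 μ ^ 2 = ∫⁻ x, ‖f x‖ₑ ^ 2 ∂μ := by
  rw [eLpNorm_eq_lintegral_rpow_enorm_toReal (by norm_num) (by norm_num),
    ← ENNReal.rpow_natCast, ← ENNReal.rpow_mul]
  simp

theorem enorm_add_sq_le (a b : ℝ) : ‖a + b‖ₑ ^ 2 ≤ 2 * (‖a‖ₑ ^ 2 + ‖b‖ₑ ^ 2) := by
  have h := ENNReal.rpow_add_le_mul_rpow_add_rpow ‖a‖ₑ ‖b‖ₑ (p := 2) (by norm_num)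
  norm_num at h
  exact (pow_le_pow_left' (enorm_add_le a b) 2).trans h

/-- Split `u` into its average at a small scale `r` and the remainder, which is small in `L^p`. If
the average stayed below `δ` everywhere, its `p`-th power would integrate to at most `δ^(p-2)` times
its `L²` bound. Both pieces together would then be too small for a unit `L^p` norm. -/
theorem exists_le_abs_ballAvg {s p : ℝ} (hs : 0 < s) (hp : 2 < p)
    (hps : (N : ℝ) * (1 - 2 / p) < 2 * s) (M : ℝ) :
    ∃ r δ : ℝ, 0 < r ∧ 0 < δ ∧ ∀ u : 𝔼 → ℝ, MemLp u 2 →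
      ∫⁻ x, ‖u x‖ₑ ^ 2 ≤ ENNReal.ofReal M → gagliardoSq s u ≤ ENNReal.ofReal M →
      ∫⁻ x, ‖u x‖ₑ ^ p = 1 → ∃ x, δ ≤ |ballAvg r u x| := by
  have hpp : 0 < p := by linarith
  set D : ℝ≥0∞ := 2 ^ (p - 1) with hD
  have hDf : D ≠ ∞ := ENNReal.rpow_ne_top_of_nonneg (by linarith) (by norm_num)
  have hD0 : D ≠ 0 := by
    rw [hD]; exact (ENNReal.rpow_pos (by norm_num) (by norm_num)).ne'
  obtain ⟨r, hr, H⟩ := exists_radius_lintegral_sub_ballAvg_le (N := N) hs hp hps M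
    -- After multiplication by the convexity constant `D`, the remainder contributes at most one
    -- half. The choice of `δ` makes the average contribute strictly less than the other half.
    (η := D⁻¹ * 2⁻¹) (mul_ne_zero (ENNReal.inv_ne_zero.2 hDf) (by norm_num))
  set L : ℝ≥0∞ := 2 * ((volume (ball (0 : 𝔼) 1))⁻¹ * ENNReal.ofReal (r ^ (2 * s)) *
    ENNReal.ofReal M + ENNReal.ofReal M) with hL
  have hLf : L ≠ ∞ := by
    refine ENNReal.mul_ne_top (by norm_num) (ENNReal.add_ne_top.2 ⟨?_, ENNReal.ofReal_ne_top⟩)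
    exact ENNReal.mul_ne_top (ENNReal.mul_ne_top
      (ENNReal.inv_ne_top.2 (measure_ball_pos volume _ one_pos).ne') ENNReal.ofReal_ne_top)
      ENNReal.ofReal_ne_top
  have hlim : Tendsto (fun δ : ℝ => D * L * ENNReal.ofReal (δ ^ (p - 2))) (𝓝[>] 0) (𝓝 0) := by
    have h1 : Tendsto (fun δ : ℝ => δ ^ (p - 2)) (𝓝[>] 0) (𝓝 0) := by
      have := (Real.continuousAt_rpow_const 0 (p - 2) (Or.inr (by linarith))).tendsto
      rw [Real.zero_rpow (by linarith)] at this
      exact this.mono_left nhdsWithin_le_nhds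
    have h2 := ENNReal.Tendsto.const_mul (ENNReal.tendsto_ofReal h1) (a := D * L)
      (Or.inr (ENNReal.mul_ne_top hDf hLf))
    simpa using h2
  obtain ⟨δ, hδ, hδ0⟩ := ((hlim.eventually (gt_mem_nhds (show (0 : ℝ≥0∞) < 2⁻¹ by norm_num))).and
    self_mem_nhdsWithin).exists
  have hδ0 : 0 < δ := hδ0
  refine ⟨r, δ, hr, hδ0, fun u hu hM hg h1 => ?_⟩
  by_contra! hcon
  have hAm := measurable_ballAvg r hu.aestronglyMeasurable
  have i1 : ∫⁻ x, ‖ballAvg r u x‖ₑ ^ 2 ≤ L := by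
    have j1 : ∀ x, ‖ballAvg r u x‖ₑ ^ 2 ≤
        2 * (‖u x - ballAvg r u x‖ₑ ^ 2 + ‖u x‖ₑ ^ 2) := fun x => by
      have := enorm_add_sq_le (-(u x - ballAvg r u x)) (u x)
      rw [enorm_neg] at this
      convert this using 3
      ring
    refine (lintegral_mono j1).trans ?_
    rw [lintegral_const_mul' _ _ (by norm_num), lintegral_add_right'
      _ (hu.aestronglyMeasurable.enorm.pow_const 2)]
    rw [hL]
    gcongr
    exact (lintegral_enorm_sub_ballAvg_sq_le hs.le hr hu).trans (mul_le_mul_right hg _)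
  have i2 : ∫⁻ x, ‖ballAvg r u x‖ₑ ^ p ≤ ENNReal.ofReal (δ ^ (p - 2)) * L := by
    have j1 : ∀ x, ‖ballAvg r u x‖ₑ ^ p ≤
        ENNReal.ofReal (δ ^ (p - 2)) * ‖ballAvg r u x‖ₑ ^ 2 := fun x => by
      have : ‖ballAvg r u x‖ₑ ^ p = ‖ballAvg r u x‖ₑ ^ (p - 2) * ‖ballAvg r u x‖ₑ ^ 2 := by
        rw [← ENNReal.rpow_natCast, ← ENNReal.rpow_add_of_nonneg _ _ (by linarith) (by norm_num)]
        norm_num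
      rw [this]
      gcongr
      rw [← ENNReal.ofReal_rpow_of_nonneg hδ0.le (by linarith), ← ofReal_norm, Real.norm_eq_abs]
      exact ENNReal.rpow_le_rpow (ENNReal.ofReal_le_ofReal (hcon x).le) (by linarith)
    refine (lintegral_mono j1).trans ?_
    rw [lintegral_const_mul' _ _ ENNReal.ofReal_ne_top]
    exact mul_le_mul_right i1 _
  have i3 : ∫⁻ x, ‖u x‖ₑ ^ p ≤ D * ((∫⁻ x, ‖u x - ballAvg r u x‖ₑ ^ p) +
      ∫⁻ x, ‖ballAvg r u x‖ₑ ^ p) := by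
    rw [← lintegral_add_right _ (hAm.enorm.pow_const p), ← lintegral_const_mul' _ _ hDf]
    refine lintegral_mono fun x => ?_
    refine le_trans ?_ (ENNReal.rpow_add_le_mul_rpow_add_rpow _ _ (by linarith))
    refine ENNReal.rpow_le_rpow ?_ hpp.le
    simpa using enorm_add_le (u x - ballAvg r u x) (ballAvg r u x)
  rw [h1] at i3
  have i4 : D * ((∫⁻ x, ‖u x - ballAvg r u x‖ₑ ^ p) + ∫⁻ x, ‖ballAvg r u x‖ₑ ^ p) < 1 := by
    calc _ ≤ D * (D⁻¹ * 2⁻¹ + ENNReal.ofReal (δ ^ (p - 2)) * L) := by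
          gcongr
          exact H u hu hg
      _ = 2⁻¹ + D * L * ENNReal.ofReal (δ ^ (p - 2)) := by
          rw [mul_add, ← mul_assoc, ENNReal.mul_inv_cancel hD0 hDf]
          ring
      _ < 2⁻¹ + 2⁻¹ := ENNReal.add_lt_add_left (by norm_num) hδ
      _ = 1 := ENNReal.inv_two_add_inv_two
  exact absurd i3 (not_le.2 i4)

/-! ### Almost everywhere convergent subsequences -/

/-- Sequential Banach–Alaoglu in `L²`, tested on indicators. One subsequence serves all sets of
finite measure, hence all ball averages at all scales. -/
theorem exists_subseq_tendsto_setIntegral {α : Type*} [MeasurableSpace α]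
    [MeasurableSpace.CountablyGenerated α] {μ : Measure α} [SFinite μ] {v : ℕ → α → ℝ} {M : ℝ}
    (hv : ∀ n, MemLp (v n) 2 μ) (hM : ∀ n, eLpNorm (v n) 2 μ ≤ ENNReal.ofReal M) :
    ∃ φ : ℕ → ℕ, StrictMono φ ∧ ∀ B : Set α, MeasurableSet B → μ B ≠ ∞ →
      ∃ l, Tendsto (fun n => ∫ y in B, v (φ n) y ∂μ) atTop (𝓝 l) := by
  have : Fact ((2 : ℝ≥0∞) ≠ ∞) := ⟨by norm_num⟩
  let x : ℕ → WeakDual ℝ (Lp ℝ 2 μ) := fun n =>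
    StrongDual.toWeakDual (innerSL ℝ ((hv n).toLp (v n)))
  have hx : ∀ n, x n ∈ WeakDual.toStrongDual ⁻¹'
      closedBall (0 : StrongDual ℝ (Lp ℝ 2 μ)) (max M 0) := fun n => by
    have : ‖innerSL ℝ ((hv n).toLp (v n))‖ ≤ max M 0 := by
      rw [innerSL_apply_norm, Lp.norm_toLp]
      refine ENNReal.toReal_le_of_le_ofReal (le_max_right _ _) ((hM n).trans ?_)
      exact ENNReal.ofReal_le_ofReal (le_max_left _ _)
    simpa [x] using this
  obtain ⟨f, -, φ, hφ, hf⟩ := WeakDual.isSeqCompact_closedBall ℝ (Lp ℝ 2 μ) 0 (max M 0) hx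
  refine ⟨φ, hφ, fun B hB hBf => ⟨f (indicatorConstLp 2 hB hBf 1), ?_⟩⟩
  have h1 := ((WeakBilin.eval_continuous _ (indicatorConstLp 2 hB hBf (1 : ℝ))).tendsto f).comp hf
  refine h1.congr fun n => ?_
  have h2 : ∫ y in B, v (φ n) y ∂μ = ∫ y in B, (hv (φ n)).toLp (v (φ n)) y ∂μ :=
    integral_congr_ae (ae_restrict_of_ae (hv (φ n)).coeFn_toLp.symm)
  rw [h2, ← L2.inner_indicatorConstLp_one (𝕜 := ℝ) hB hBf, real_inner_comm]
  rfl

/-- A finite measure with the same null sets makes constants integrable dominating functions, and no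
exhaustion by balls with a diagonal argument is needed. -/
theorem exists_finite_measure_le {α : Type*} [MeasurableSpace α] (μ : Measure α) [SigmaFinite μ] :
    ∃ ρ : Measure α, IsFiniteMeasure ρ ∧ ρ ≤ μ ∧ μ ≪ ρ := by
  obtain ⟨g, hg0, hgm, hg⟩ := exists_pos_lintegral_lt_of_sigmaFinite μ (one_ne_zero (α := ℝ≥0∞))
  set h : α → ℝ≥0∞ := fun x => min (g x) 1 with hh
  have hhm : Measurable h := by fun_prop
  refine ⟨μ.withDensity h, ?_, ?_, ?_⟩
  · refine isFiniteMeasure_withDensity (ne_top_of_le_ne_top hg.ne_top ?_)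
    exact lintegral_mono fun x => min_le_left _ _
  · conv_rhs => rw [← withDensity_one (μ := μ)]
    exact withDensity_mono (Eventually.of_forall fun x => min_le_right _ _)
  · refine withDensity_absolutelyContinuous' hhm.aemeasurable (Eventually.of_forall fun x => ?_)
    have := hg0 x
    simp [hh, this.ne']

theorem exists_subseq_tendsto_ae_of_cauchy {α : Type*} [MeasurableSpace α] {ρ : Measure α}
    {v : ℕ → α → ℝ} (hv : ∀ n, AEStronglyMeasurable (v n) ρ)
    (h : ∀ η : ℝ≥0∞, η ≠ 0 → ∀ᶠ k in atTop, ∀ i j, k ≤ i → k ≤ j →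
      ∫⁻ x, ‖v i x - v j x‖ₑ ^ 2 ∂ρ < η) :
    ∃ φ : ℕ → ℕ, StrictMono φ ∧
      ∀ᵐ x ∂ρ, ∃ l, Tendsto (fun n => v (φ n) x) atTop (𝓝 l) := by
  obtain ⟨φ, hφ, H⟩ := extraction_forall_of_eventually
    (P := fun n k => ∀ i j, k ≤ i → k ≤ j → ∫⁻ x, ‖v i x - v j x‖ₑ ^ 2 ∂ρ < ((2⁻¹ : ℝ≥0∞) ^ n) ^ 2)
    (fun n => h _ (by simp))
  refine ⟨φ, hφ, Lp.ae_tendsto_of_cauchy_eLpNorm (p := 2) (f := fun n => v (φ n))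
    (fun n => hv _) (by norm_num) (B := fun n => (2⁻¹ : ℝ≥0∞) ^ n) ?_ ?_⟩
  · rw [ENNReal.tsum_geometric]
    simp
  · intro k n m hn hm
    have h1 := H k (φ n) (φ m) (hφ.monotone hn) (hφ.monotone hm)
    refine lt_of_pow_lt_pow_left' 2 ?_
    rw [sq_eLpNorm_two]
    exact h1

/-- The approximant is the pointwise limit of the averages at one small scale. The averages are
uniformly bounded, so they converge in `L²(ρ)` by dominated convergence, while the seminorm controls
their distance to `v n`. -/
theorem exists_lintegral_sub_le_of_tendsto_ballAvg {s : ℝ} (hs : 0 < s) {v : ℕ → 𝔼 → ℝ} {M : ℝ}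
    (hv : ∀ n, MemLp (v n) 2) (hM : ∀ n, ∫⁻ x, ‖v n x‖ₑ ^ 2 ≤ ENNReal.ofReal M)
    (hg : ∀ n, gagliardoSq s (v n) ≤ ENNReal.ofReal M)
    {ρ : Measure (EuclideanSpace ℝ (Fin N))} [IsFiniteMeasure ρ] (hρ : ρ ≤ volume)
    (havg : ∀ r x, ∃ l, Tendsto (fun n => ballAvg r (v n) x) atTop (𝓝 l))
    {η : ℝ≥0∞} (hη : η ≠ 0) :
    ∃ h : 𝔼 → ℝ, AEMeasurable h ρ ∧ ∀ᶠ n in atTop, ∫⁻ x, ‖v n x - h x‖ₑ ^ 2 ∂ρ < η := by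
  set c : ℝ≥0∞ := (volume (ball (0 : 𝔼) 1))⁻¹ with hc
  have hcf : c ≠ ∞ := ENNReal.inv_ne_top.2 (measure_ball_pos volume _ one_pos).ne'
  have l1 : Tendsto (fun r : ℝ => 2 * (c * ENNReal.ofReal M) * ENNReal.ofReal (r ^ (2 * s)))
      (𝓝[>] 0) (𝓝 0) := by
    have h1 : Tendsto (fun δ : ℝ => δ ^ (2 * s)) (𝓝[>] 0) (𝓝 0) := by
      have := (Real.continuousAt_rpow_const 0 (2 * s) (Or.inr (by positivity))).tendsto
      rw [Real.zero_rpow (by positivity)] at this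
      exact this.mono_left nhdsWithin_le_nhds
    have h2 := ENNReal.Tendsto.const_mul (ENNReal.tendsto_ofReal h1)
      (a := 2 * (c * ENNReal.ofReal M))
      (Or.inr (ENNReal.mul_ne_top (by norm_num) (ENNReal.mul_ne_top hcf ENNReal.ofReal_ne_top)))
    simpa using h2
  have hη2 : 0 < η / 2 := ENNReal.half_pos hη
  obtain ⟨r, hr1, hr⟩ := ((l1.eventually (gt_mem_nhds hη2)).and self_mem_nhdsWithin).exists
  have hr : 0 < r := hr
  choose h hh using havg r
  have hAm : ∀ n, Measurable (ballAvg r (v n)) := fun n =>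
    measurable_ballAvg r (hv n).aestronglyMeasurable
  have hhm : Measurable h := measurable_of_tendsto_metrizable hAm (tendsto_pi_nhds.2 hh)
  set K : ℝ≥0∞ := (volume (ball (0 : 𝔼) r))⁻¹ * ENNReal.ofReal M with hK
  have hKf : K ≠ ∞ := ENNReal.mul_ne_top
    (ENNReal.inv_ne_top.2 (measure_ball_pos volume _ hr).ne') ENNReal.ofReal_ne_top
  have hAK : ∀ n x, ‖ballAvg r (v n) x‖ₑ ^ 2 ≤ K := fun n x =>
    (enorm_ballAvg_sq_le hr (hv n) x).trans (mul_le_mul_right (hM n) _)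
  have hhK : ∀ x, ‖h x‖ₑ ^ 2 ≤ K := fun x =>
    le_of_tendsto ((ENNReal.continuous_pow 2).continuousAt.tendsto.comp (hh x).enorm)
      (Eventually.of_forall fun n => hAK n x)
  have l2 : Tendsto (fun n => 2 * ∫⁻ x, ‖ballAvg r (v n) x - h x‖ₑ ^ 2 ∂ρ) atTop (𝓝 0) := by
    have h1 : Tendsto (fun n => ∫⁻ x, ‖ballAvg r (v n) x - h x‖ₑ ^ 2 ∂ρ) atTop
        (𝓝 (∫⁻ _, 0 ∂ρ)) := by
      refine tendsto_lintegral_of_dominated_convergence (fun _ => 2 * (K + K)) (fun n => ?_)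
        (fun n => Eventually.of_forall fun x => ?_) ?_ (Eventually.of_forall fun x => ?_)
      · exact ((hAm n).sub hhm).enorm.pow_const 2
      · have := enorm_add_sq_le (ballAvg r (v n) x) (-h x)
        rw [enorm_neg, ← sub_eq_add_neg] at this
        exact this.trans (mul_le_mul_right (add_le_add (hAK n x) (hhK x)) _)
      · rw [lintegral_const]
        exact ENNReal.mul_ne_top (ENNReal.mul_ne_top (by norm_num)
          (ENNReal.add_ne_top.2 ⟨hKf, hKf⟩)) (measure_ne_top _ _)
      · have h2 : Tendsto (fun n => ‖ballAvg r (v n) x - h x‖ₑ) atTop (𝓝 ‖h x - h x‖ₑ) :=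
          ((hh x).sub_const (h x)).enorm
        rw [sub_self, enorm_zero] at h2
        have h3 := ((ENNReal.continuous_pow 2).tendsto 0).comp h2
        rw [zero_pow two_ne_zero] at h3
        exact h3
    rw [lintegral_zero] at h1
    simpa using ENNReal.Tendsto.const_mul h1 (a := 2) (Or.inr (by norm_num))
  refine ⟨h, hhm.aemeasurable, ?_⟩
  filter_upwards [l2.eventually (gt_mem_nhds hη2)] with n hn
  have i1 : ∫⁻ x, ‖v n x - ballAvg r (v n) x‖ₑ ^ 2 ∂ρ ≤
      c * ENNReal.ofReal (r ^ (2 * s)) * ENNReal.ofReal M :=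
    (lintegral_mono' hρ le_rfl).trans
      ((lintegral_enorm_sub_ballAvg_sq_le hs.le hr (hv n)).trans (mul_le_mul_right (hg n) _))
  calc ∫⁻ x, ‖v n x - h x‖ₑ ^ 2 ∂ρ
      ≤ ∫⁻ x, 2 * (‖v n x - ballAvg r (v n) x‖ₑ ^ 2 + ‖ballAvg r (v n) x - h x‖ₑ ^ 2) ∂ρ := by
        refine lintegral_mono fun x => ?_
        simpa using enorm_add_sq_le (v n x - ballAvg r (v n) x) (ballAvg r (v n) x - h x)
    _ = 2 * (∫⁻ x, ‖v n x - ballAvg r (v n) x‖ₑ ^ 2 ∂ρ) +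
        2 * ∫⁻ x, ‖ballAvg r (v n) x - h x‖ₑ ^ 2 ∂ρ := by
        have h3 : Measurable fun x => ‖ballAvg r (v n) x - h x‖ₑ ^ 2 :=
          ((hAm n).sub hhm).enorm.pow_const 2
        rw [lintegral_const_mul' _ _ (by norm_num), lintegral_add_right _ h3, mul_add]
    _ ≤ 2 * (c * ENNReal.ofReal M) * ENNReal.ofReal (r ^ (2 * s)) +
        2 * ∫⁻ x, ‖ballAvg r (v n) x - h x‖ₑ ^ 2 ∂ρ := by
        refine add_le_add_left ((mul_le_mul_right i1 _).trans (le_of_eq ?_)) _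
        ring
    _ < η / 2 + η / 2 := ENNReal.add_lt_add hr1 hn
    _ = η := ENNReal.add_halves η

theorem exists_subseq_tendsto_ae {s : ℝ} (hs : 0 < s) {v : ℕ → 𝔼 → ℝ} {M : ℝ}
    (hv : ∀ n, MemLp (v n) 2) (hM : ∀ n, ∫⁻ x, ‖v n x‖ₑ ^ 2 ≤ ENNReal.ofReal M)
    (hg : ∀ n, gagliardoSq s (v n) ≤ ENNReal.ofReal M) :
    ∃ (φ : ℕ → ℕ) (w : 𝔼 → ℝ), StrictMono φ ∧ AEStronglyMeasurable w ∧
      ∀ᵐ x, Tendsto (fun n => v (φ n) x) atTop (𝓝 (w x)) := by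
  have hM' : ∀ n, eLpNorm (v n) 2 volume ≤ ENNReal.ofReal √M := fun n => by
    refine (ENNReal.pow_le_pow_left_iff two_ne_zero).1 ?_
    rw [sq_eLpNorm_two, ← ENNReal.ofReal_pow (Real.sqrt_nonneg _)]
    refine (hM n).trans ?_
    rcases le_total 0 M with h | h
    · rw [Real.sq_sqrt h]
    · rw [ENNReal.ofReal_of_nonpos h]; exact zero_le
  obtain ⟨φ, hφ, hφB⟩ := exists_subseq_tendsto_setIntegral hv hM'
  obtain ⟨ρ, hρf, hρ, hρ'⟩ := exists_finite_measure_le (volume : Measure 𝔼)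
  have hvρ : ∀ n, AEStronglyMeasurable (v n) ρ := fun n =>
    (hv n).aestronglyMeasurable.mono_measure hρ
  have hcau : ∀ η : ℝ≥0∞, η ≠ 0 → ∀ᶠ k in atTop, ∀ i j, k ≤ i → k ≤ j →
      ∫⁻ x, ‖v (φ i) x - v (φ j) x‖ₑ ^ 2 ∂ρ < η := by
    intro η hη
    obtain ⟨h, hhm, hh⟩ := exists_lintegral_sub_le_of_tendsto_ballAvg hs (fun n => hv (φ n))
      (fun n => hM _) (fun n => hg _) hρ (fun r x => by
        obtain ⟨l, hl⟩ := hφB (ball x r) measurableSet_ball measure_ball_lt_top.ne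
        refine ⟨(volume.real (ball x r))⁻¹ * l, ?_⟩
        simp only [ballAvg, setAverage_eq, smul_eq_mul]
        exact hl.const_mul _) (η := η / 4) (by simpa using hη)
    obtain ⟨k₀, hk₀⟩ := eventually_atTop.1 hh
    filter_upwards [eventually_ge_atTop k₀] with k hk i j hi hj
    have hi' := hk₀ i (hk.trans hi)
    have hj' := hk₀ j (hk.trans hj)
    calc ∫⁻ x, ‖v (φ i) x - v (φ j) x‖ₑ ^ 2 ∂ρ
        ≤ ∫⁻ x, 2 * (‖v (φ i) x - h x‖ₑ ^ 2 + ‖v (φ j) x - h x‖ₑ ^ 2) ∂ρ := by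
          refine lintegral_mono fun x => ?_
          have := enorm_add_sq_le (v (φ i) x - h x) (-(v (φ j) x - h x))
          rw [enorm_neg] at this
          simpa using this
      _ = 2 * ((∫⁻ x, ‖v (φ i) x - h x‖ₑ ^ 2 ∂ρ) + ∫⁻ x, ‖v (φ j) x - h x‖ₑ ^ 2 ∂ρ) := by
          rw [lintegral_const_mul' _ _ (by norm_num), lintegral_add_right']
          exact (((hvρ _).aemeasurable.sub hhm).enorm.pow_const 2)
      _ < 2 * (η / 4 + η / 4) :=
          (ENNReal.mul_lt_mul_iff_right (by norm_num) (by norm_num)).2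
            (ENNReal.add_lt_add hi' hj')
      _ = η := by
          rw [← two_mul, ← mul_assoc, ENNReal.div_eq_inv_mul, ← mul_assoc]
          have : (2 * 2 * 4⁻¹ : ℝ≥0∞) = 1 := by
            rw [show (2 * 2 : ℝ≥0∞) = 4 by norm_num]
            exact ENNReal.mul_inv_cancel (by norm_num) (by norm_num)
          rw [this, one_mul]
  obtain ⟨ψ, hψ, hψt⟩ := exists_subseq_tendsto_ae_of_cauchy (fun n => hvρ (φ n)) hcau
  have hlim : ∀ᵐ x, Tendsto (fun n => v (φ (ψ n)) x) atTop
      (𝓝 (limUnder atTop (fun n => v (φ (ψ n)) x))) := by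
    filter_upwards [hρ'.ae_le hψt] with x hx
    exact tendsto_nhds_limUnder hx
  refine ⟨fun n => φ (ψ n), _, hφ.comp hψ, ?_, hlim⟩
  exact aestronglyMeasurable_of_tendsto_ae atTop (fun n => (hv _).aestronglyMeasurable) hlim

/-! ### Brezis–Lieb splitting -/

/-- Either `b` is a small multiple of `a`, and the factor `c` absorbs it, or `a` is bounded by a
multiple of `b`. The slack `c > 1` gives the splitting below a dominating function that does not
depend on `n`. -/
theorem exists_ennreal_add_rpow_le {p : ℝ} (hp : 0 < p) {c : ℝ≥0∞} (hc : 1 < c) :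
    ∃ C : ℝ≥0∞, C ≠ ∞ ∧ ∀ a b : ℝ≥0∞, (a + b) ^ p ≤ c * a ^ p + C * b ^ p := by
  have h1 : Tendsto (fun η : ℝ≥0∞ => (1 + η) ^ p) (𝓝[>] 0) (𝓝 1) := by
    have h2 : Tendsto (fun η : ℝ≥0∞ => (1 + η) ^ p) (𝓝 0) (𝓝 ((1 + 0) ^ p)) :=
      ((ENNReal.continuous_rpow_const (y := p)).tendsto _).comp
        (tendsto_const_nhds.add tendsto_id)
    rw [add_zero, ENNReal.one_rpow] at h2
    exact h2.mono_left nhdsWithin_le_nhds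
  have : (𝓝[>] (0 : ℝ≥0∞)).NeBot := nhdsGT_neBot_of_exists_gt ⟨1, one_pos⟩
  obtain ⟨η, ⟨hη, hη0⟩⟩ := ((h1.eventually (gt_mem_nhds hc)).and self_mem_nhdsWithin).exists
  have hη0 : 0 < η := hη0
  rcases eq_or_ne η ∞ with rfl | hηf
  · simp [ENNReal.top_rpow_of_pos hp] at hη
  refine ⟨(η⁻¹ + 1) ^ p, ENNReal.rpow_ne_top_of_nonneg hp.le
    (ENNReal.add_ne_top.2 ⟨ENNReal.inv_ne_top.2 hη0.ne', by norm_num⟩), fun a b => ?_⟩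
  rcases le_total b (η * a) with h | h
  · calc (a + b) ^ p ≤ ((1 + η) * a) ^ p := by
          refine ENNReal.rpow_le_rpow ?_ hp.le
          rw [add_mul, one_mul]
          exact add_le_add_right h a
      _ = (1 + η) ^ p * a ^ p := ENNReal.mul_rpow_of_nonneg _ _ hp.le
      _ ≤ c * a ^ p := by gcongr
      _ ≤ _ := le_self_add
  · have h2 : a ≤ η⁻¹ * b := by
      rw [mul_comm, ← div_eq_mul_inv, ENNReal.le_div_iff_mul_le (Or.inl hη0.ne') (Or.inl hηf),
        mul_comm]
      exact h
    calc (a + b) ^ p ≤ ((η⁻¹ + 1) * b) ^ p := by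
          refine ENNReal.rpow_le_rpow ?_ hp.le
          rw [add_mul, one_mul]
          exact add_le_add_left h2 b
      _ = (η⁻¹ + 1) ^ p * b ^ p := ENNReal.mul_rpow_of_nonneg _ _ hp.le
      _ ≤ _ := le_add_self

section BrezisLieb

variable {α : Type*} [MeasurableSpace α] {μ : Measure α} {p : ℝ} {f : ℕ → α → ℝ} {g : α → ℝ}
  {c : ℝ≥0∞}

theorem tendsto_enorm_rpow_of_tendsto {a : ℕ → ℝ} {b : ℝ} (p : ℝ)
    (h : Tendsto a atTop (𝓝 b)) : Tendsto (fun n => ‖a n‖ₑ ^ p) atTop (𝓝 (‖b‖ₑ ^ p)) :=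
  ((ENNReal.continuous_rpow_const (y := p)).tendsto _).comp h.enorm

/-- One half of the Brezis–Lieb lemma: `∫ |f n|^p ≤ c ∫ |f n - g|^p + ∫ |g|^p + o(1)`. -/
theorem tendsto_lintegral_brezisLieb_upper (hp : 0 < p) (hc : 1 < c) (hcf : c ≠ ∞)
    (hf : ∀ n, AEMeasurable (f n) μ) (hg : AEMeasurable g μ)
    (hlim : ∀ᵐ x ∂μ, Tendsto (fun n => f n x) atTop (𝓝 (g x)))
    (hgp : ∫⁻ x, ‖g x‖ₑ ^ p ∂μ ≠ ∞) :
    Tendsto (fun n => ∫⁻ x, (‖f n x‖ₑ ^ p - (c * ‖f n x - g x‖ₑ ^ p + ‖g x‖ₑ ^ p)) ∂μ) atTop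
      (𝓝 0) := by
  obtain ⟨C, hC, H⟩ := exists_ennreal_add_rpow_le hp hc
  rw [← lintegral_zero (μ := μ)]
  -- Truncated subtraction keeps only the positive part of the defect, and this part alone is
  -- dominated by a multiple of `|g|^p`.
  refine tendsto_lintegral_of_dominated_convergence' (fun x => C * ‖g x‖ₑ ^ p) (fun n => ?_)
    (fun n => Eventually.of_forall fun x => ?_) ?_ ?_
  · exact ((hf n).enorm.pow_const p).sub
      (((((hf n).sub hg).enorm.pow_const p).const_mul c).add (hg.enorm.pow_const p))
  · rw [tsub_le_iff_right]
    calc ‖f n x‖ₑ ^ p ≤ (‖f n x - g x‖ₑ + ‖g x‖ₑ) ^ p := by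
          refine ENNReal.rpow_le_rpow ?_ hp.le
          simpa using enorm_add_le (f n x - g x) (g x)
      _ ≤ c * ‖f n x - g x‖ₑ ^ p + C * ‖g x‖ₑ ^ p := H _ _
      _ ≤ C * ‖g x‖ₑ ^ p + (c * ‖f n x - g x‖ₑ ^ p + ‖g x‖ₑ ^ p) := by
          rw [← add_assoc, add_comm (C * _)]
          exact le_self_add
  · rw [lintegral_const_mul' _ _ hC]
    exact ENNReal.mul_ne_top hC hgp
  · filter_upwards [hlim] with x hx
    have h1 := tendsto_enorm_rpow_of_tendsto p hx
    have h2 := tendsto_enorm_rpow_of_tendsto p (hx.sub_const (g x))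
    rw [sub_self, enorm_zero, ENNReal.zero_rpow_of_pos hp] at h2
    have h3 := ENNReal.Tendsto.sub h1 ((ENNReal.Tendsto.const_mul h2 (a := c)
      (Or.inr hcf)).add_const (‖g x‖ₑ ^ p))
      (Or.inl (ENNReal.rpow_ne_top_of_nonneg hp.le enorm_ne_top))
    simpa using h3

/-- The other half of the Brezis–Lieb lemma: `∫ |f n - g|^p + ∫ |g|^p ≤ c ∫ |f n|^p + o(1)`. -/
theorem tendsto_lintegral_brezisLieb_lower (hp : 0 < p) (hc : 1 < c) (hcf : c ≠ ∞)
    (hf : ∀ n, AEMeasurable (f n) μ) (hg : AEMeasurable g μ)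
    (hlim : ∀ᵐ x ∂μ, Tendsto (fun n => f n x) atTop (𝓝 (g x)))
    (hgp : ∫⁻ x, ‖g x‖ₑ ^ p ∂μ ≠ ∞) :
    Tendsto (fun n => ∫⁻ x, (‖f n x - g x‖ₑ ^ p + ‖g x‖ₑ ^ p - c * ‖f n x‖ₑ ^ p) ∂μ) atTop
      (𝓝 0) := by
  obtain ⟨C, hC, H⟩ := exists_ennreal_add_rpow_le hp hc
  rw [← lintegral_zero (μ := μ)]
  refine tendsto_lintegral_of_dominated_convergence' (fun x => (C + 1) * ‖g x‖ₑ ^ p)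
    (fun n => ?_) (fun n => Eventually.of_forall fun x => ?_) ?_ ?_
  · exact ((((hf n).sub hg).enorm.pow_const p).add (hg.enorm.pow_const p)).sub
      (((hf n).enorm.pow_const p).const_mul c)
  · rw [tsub_le_iff_right]
    calc ‖f n x - g x‖ₑ ^ p + ‖g x‖ₑ ^ p ≤ (‖f n x‖ₑ + ‖g x‖ₑ) ^ p + ‖g x‖ₑ ^ p := by
          gcongr
          exact enorm_sub_le
      _ ≤ c * ‖f n x‖ₑ ^ p + C * ‖g x‖ₑ ^ p + ‖g x‖ₑ ^ p := by gcongr; exact H _ _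
      _ = (C + 1) * ‖g x‖ₑ ^ p + c * ‖f n x‖ₑ ^ p := by ring
  · have hC1 : C + 1 ≠ ∞ := ENNReal.add_ne_top.2 ⟨hC, by norm_num⟩
    rw [lintegral_const_mul' _ _ hC1]
    exact ENNReal.mul_ne_top hC1 hgp
  · filter_upwards [hlim] with x hx
    have h1 := tendsto_enorm_rpow_of_tendsto p hx
    have h2 := tendsto_enorm_rpow_of_tendsto p (hx.sub_const (g x))
    rw [sub_self, enorm_zero, ENNReal.zero_rpow_of_pos hp] at h2
    have hgf : ‖g x‖ₑ ^ p ≠ ∞ := ENNReal.rpow_ne_top_of_nonneg hp.le enorm_ne_top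
    have h3 := ENNReal.Tendsto.sub (h2.add_const (‖g x‖ₑ ^ p))
      (ENNReal.Tendsto.const_mul h1 (a := c) (Or.inr hcf)) (Or.inl (by simpa using hgf))
    rw [zero_add, tsub_eq_zero_of_le (le_mul_of_one_le_left' hc.le)] at h3
    exact h3

theorem lintegral_le_of_tendsto_ae {F : ℕ → α → ℝ≥0∞} {G : α → ℝ≥0∞} {M : ℝ≥0∞}
    (hF : ∀ n, AEMeasurable (F n) μ) (hlim : ∀ᵐ x ∂μ, Tendsto (fun n => F n x) atTop (𝓝 (G x)))
    (hM : ∃ᶠ n in atTop, ∫⁻ x, F n x ∂μ ≤ M) : ∫⁻ x, G x ∂μ ≤ M := by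
  calc ∫⁻ x, G x ∂μ = ∫⁻ x, liminf (fun n => F n x) atTop ∂μ := by
        refine lintegral_congr_ae ?_
        filter_upwards [hlim] with x hx
        exact hx.liminf_eq.symm
    _ ≤ liminf (fun n => ∫⁻ x, F n x ∂μ) atTop := lintegral_liminf_le' hF
    _ ≤ M := liminf_le_of_frequently_le' hM

/-- An `L²` bound gives uniform integrability. The excess of `|f|` over `t |f|²` is at most `1/t`,
so it tends to zero by dominated convergence, and the rest is at most `t M`. -/
theorem eventually_lintegral_enorm_le_of_tendsto_zero [IsFiniteMeasure μ] {M : ℝ≥0∞}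
    (hM : M ≠ ∞) (hf : ∀ n, AEMeasurable (f n) μ)
    (hlim : ∀ᵐ x ∂μ, Tendsto (fun n => f n x) atTop (𝓝 0))
    (h2 : ∀ n, ∫⁻ x, ‖f n x‖ₑ ^ 2 ∂μ ≤ M) {β : ℝ≥0∞} (hβ : β ≠ 0) :
    ∀ᶠ n in atTop, ∫⁻ x, ‖f n x‖ₑ ∂μ ≤ β := by
  have hβ2 : 0 < β / 2 := ENNReal.half_pos hβ
  have hl : Tendsto (fun t : ℝ≥0∞ => t * M) (𝓝[>] 0) (𝓝 0) := by
    have : Tendsto (fun t : ℝ≥0∞ => t * M) (𝓝 0) (𝓝 (0 * M)) :=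
      ENNReal.Tendsto.mul_const tendsto_id (Or.inr hM)
    rw [zero_mul] at this
    exact this.mono_left nhdsWithin_le_nhds
  have : (𝓝[>] (0 : ℝ≥0∞)).NeBot := nhdsGT_neBot_of_exists_gt ⟨1, one_pos⟩
  obtain ⟨t, ht, ht0⟩ := ((hl.eventually (gt_mem_nhds hβ2)).and self_mem_nhdsWithin).exists
  have ht0 : 0 < t := ht0
  have hd : Tendsto (fun n => ∫⁻ x, (‖f n x‖ₑ - t * ‖f n x‖ₑ ^ 2) ∂μ) atTop (𝓝 0) := by
    rw [← lintegral_zero (μ := μ)]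
    refine tendsto_lintegral_of_dominated_convergence' (fun _ => t⁻¹) (fun n => ?_)
      (fun n => Eventually.of_forall fun x => ?_) ?_ ?_
    · exact (hf n).enorm.sub (((hf n).enorm.pow_const 2).const_mul t)
    · rcases le_total ‖f n x‖ₑ t⁻¹ with h | h
      · exact tsub_le_self.trans h
      · rw [tsub_le_iff_right]
        refine le_add_left ?_
        rcases eq_or_ne t ∞ with rfl | htf
        · rcases eq_or_ne ‖f n x‖ₑ 0 with h0 | h0
          · simp [h0]
          · simp [ENNReal.top_mul, h0]
        calc ‖f n x‖ₑ = (t * t⁻¹) * ‖f n x‖ₑ := by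
              rw [ENNReal.mul_inv_cancel ht0.ne' htf, one_mul]
          _ ≤ (t * ‖f n x‖ₑ) * ‖f n x‖ₑ := by gcongr
          _ = _ := by ring
    · rw [lintegral_const]
      exact ENNReal.mul_ne_top (ENNReal.inv_ne_top.2 ht0.ne') (measure_ne_top _ _)
    · filter_upwards [hlim] with x hx
      have h1 := hx.enorm
      rw [enorm_zero] at h1
      exact tendsto_of_tendsto_of_tendsto_of_le_of_le tendsto_const_nhds h1 (fun _ => zero_le)
        (fun n => tsub_le_self)
  filter_upwards [hd.eventually (gt_mem_nhds hβ2)] with n hn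
  calc ∫⁻ x, ‖f n x‖ₑ ∂μ ≤ ∫⁻ x, ((‖f n x‖ₑ - t * ‖f n x‖ₑ ^ 2) + t * ‖f n x‖ₑ ^ 2) ∂μ :=
        lintegral_mono fun x => le_tsub_add
    _ = (∫⁻ x, (‖f n x‖ₑ - t * ‖f n x‖ₑ ^ 2) ∂μ) + t * ∫⁻ x, ‖f n x‖ₑ ^ 2 ∂μ := by
        have h3 : AEMeasurable (fun x => ‖f n x‖ₑ ^ 2) μ := (hf n).enorm.pow_const 2
        rw [lintegral_add_right' _ (h3.const_mul t), lintegral_const_mul'' _ h3]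
    _ ≤ β / 2 + β / 2 := by
        refine add_le_add hn.le (le_trans ?_ ht.le)
        gcongr
        exact h2 n
    _ = β := ENNReal.add_halves β

end BrezisLieb

/-! ### The energy: translation, splitting and lower semicontinuity -/

/-- The measure `|x - y|^(-N - 2s) dx dy`. -/
def kernelMeasure (N : ℕ) (s : ℝ) :
    Measure (EuclideanSpace ℝ (Fin N) × EuclideanSpace ℝ (Fin N)) :=
  volume.withDensity fun z => ENNReal.ofReal ((‖z.1 - z.2‖ ^ ((N : ℝ) + 2 * s))⁻¹)

theorem gagliardoSq_eq_lintegral_kernelMeasure (s : ℝ) (u : 𝔼 → ℝ) :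
    gagliardoSq s u = ∫⁻ z, ‖u z.1 - u z.2‖ₑ ^ 2 ∂(kernelMeasure N s) := by
  have hm : Measurable fun z : 𝔼 × 𝔼 => ENNReal.ofReal ((‖z.1 - z.2‖ ^ ((N : ℝ) + 2 * s))⁻¹) := by
    fun_prop
  rw [kernelMeasure, lintegral_withDensity_eq_lintegral_mul_non_measurable _ hm
    (Eventually.of_forall fun _ => ENNReal.ofReal_lt_top)]
  refine lintegral_congr fun z => ?_
  rw [Pi.mul_apply, ← ofReal_norm, ← ENNReal.ofReal_pow (norm_nonneg _),
    ← ENNReal.ofReal_mul (by positivity), Real.norm_eq_abs, div_eq_mul_inv, mul_comm]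

theorem kernelMeasure_absolutelyContinuous (N : ℕ) (s : ℝ) : kernelMeasure N s ≪ volume :=
  withDensity_absolutelyContinuous _ _

theorem aemeasurable_sub_kernelMeasure (s : ℝ) {u : 𝔼 → ℝ} (hu : AEMeasurable u) :
    AEMeasurable (fun z : 𝔼 × 𝔼 => u z.1 - u z.2) (kernelMeasure N s) := by
  have h1 : AEMeasurable (fun z : 𝔼 × 𝔼 => u z.1) (volume.prod volume) :=
    hu.comp_quasiMeasurePreserving Measure.quasiMeasurePreserving_fst
  have h2 : AEMeasurable (fun z : 𝔼 × 𝔼 => u z.2) (volume.prod volume) :=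
    hu.comp_quasiMeasurePreserving Measure.quasiMeasurePreserving_snd
  exact (h1.sub h2).mono_ac (kernelMeasure_absolutelyContinuous N s)

theorem ae_kernelMeasure_tendsto_sub (s : ℝ) {v : ℕ → 𝔼 → ℝ} {w : 𝔼 → ℝ}
    (h : ∀ᵐ x, Tendsto (fun n => v n x) atTop (𝓝 (w x))) :
    ∀ᵐ z ∂(kernelMeasure N s), Tendsto (fun n => v n z.1 - v n z.2) atTop
      (𝓝 (w z.1 - w z.2)) := by
  refine (kernelMeasure_absolutelyContinuous N s).ae_le ?_
  have h1 : ∀ᵐ z : 𝔼 × 𝔼 ∂(volume.prod volume), Tendsto (fun n => v n z.1) atTop (𝓝 (w z.1)) :=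
    Measure.quasiMeasurePreserving_fst.ae h
  have h2 : ∀ᵐ z : 𝔼 × 𝔼 ∂(volume.prod volume), Tendsto (fun n => v n z.2) atTop (𝓝 (w z.2)) :=
    Measure.quasiMeasurePreserving_snd.ae h
  change ∀ᵐ z : 𝔼 × 𝔼 ∂(volume.prod volume), _
  filter_upwards [h1, h2] with z hz1 hz2
  exact hz1.sub hz2

/-- The squared norm `[u]ₛ² + ∫ V u²` with values in `[0, ∞]`. -/
def energy (s : ℝ) (V u : EuclideanSpace ℝ (Fin N) → ℝ) : ℝ≥0∞ :=
  gagliardoSq s u + ∫⁻ x, ENNReal.ofReal (V x) * ‖u x‖ₑ ^ 2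

theorem lintegral_translate (F : 𝔼 → ℝ≥0∞) (y : 𝔼) : ∫⁻ x, F (x + y) = ∫⁻ x, F x :=
  lintegral_add_right_eq_self F y

theorem gagliardoSq_translate (s : ℝ) (u : 𝔼 → ℝ) (y : 𝔼) :
    gagliardoSq s (fun x => u (x + y)) = gagliardoSq s u := by
  have h := lintegral_add_right_eq_self (μ := (volume : Measure 𝔼).prod (volume : Measure 𝔼)) (fun z : 𝔼 × 𝔼 =>
    ENNReal.ofReal (|u z.1 - u z.2| ^ 2 / ‖z.1 - z.2‖ ^ ((N : ℝ) + 2 * s))) (y, y)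
  simp only [Prod.fst_add, Prod.snd_add, add_sub_add_right_eq_sub] at h
  simp only [gagliardoSq]
  exact h

theorem energy_translate (s : ℝ) (V u : 𝔼 → ℝ) (y : 𝔼) :
    energy s (fun x => V (x + y)) (fun x => u (x + y)) = energy s V u := by
  rw [energy, energy, gagliardoSq_translate,
    lintegral_translate (fun x => ENNReal.ofReal (V x) * ‖u x‖ₑ ^ 2) y]

theorem ballAvg_translate (r : ℝ) (u : 𝔼 → ℝ) (x y : 𝔼) :
    ballAvg r (fun z => u (z + y)) x = ballAvg r u (x + y) := by
  have h := (measurePreserving_add_right volume y).setIntegral_preimage_emb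
    (measurableEmbedding_addRight y) u (ball (x + y) r)
  have h2 : (fun z => z + y) ⁻¹' ball (x + y) r = ball x r := by
    ext z; simp
  rw [h2] at h
  rw [ballAvg, ballAvg, setAverage_eq, setAverage_eq, h, measureReal_def, measureReal_def,
    Measure.addHaar_ball_center volume x, Measure.addHaar_ball_center volume (x + y)]

theorem aestronglyMeasurable_translate {u : 𝔼 → ℝ} (hu : AEStronglyMeasurable u) (y : 𝔼) :
    AEStronglyMeasurable (fun x => u (x + y)) :=
  hu.comp_measurePreserving (measurePreserving_add_right volume y)

/-- Brezis–Lieb with exponent `2`, once for the differences under `kernelMeasure` and once for the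
functions. The potentials may vary with `n`, since the defect is nonnegative and the common bound
`K` can replace them in the error. -/
theorem exists_energy_sub_add_energy_le {s K : ℝ} {v : ℕ → 𝔼 → ℝ} {w : 𝔼 → ℝ}
    {W : ℕ → 𝔼 → ℝ} (hW : ∀ n, Measurable (W n)) (hWK : ∀ n x, W n x ≤ K)
    (hv : ∀ n, AEMeasurable (v n)) (hw : AEMeasurable w)
    (hlim : ∀ᵐ x, Tendsto (fun n => v n x) atTop (𝓝 (w x)))
    (hw2 : ∫⁻ x, ‖w x‖ₑ ^ 2 ≠ ∞) (hg : gagliardoSq s w ≠ ∞) {c : ℝ≥0∞} (hc : 1 < c)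
    (hcf : c ≠ ∞) :
    ∃ R : ℕ → ℝ≥0∞, Tendsto R atTop (𝓝 0) ∧ ∀ n,
      energy s (W n) (fun x => v n x - w x) + energy s (W n) w ≤
        c * energy s (W n) (v n) + R n := by
  have h1 := tendsto_lintegral_brezisLieb_lower (p := 2) two_pos hc hcf hv hw hlim
    (by simpa using hw2)
  have h2 := tendsto_lintegral_brezisLieb_lower (p := 2) two_pos hc hcf
    (fun n => aemeasurable_sub_kernelMeasure s (hv n)) (aemeasurable_sub_kernelMeasure s hw)
    (ae_kernelMeasure_tendsto_sub s hlim)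
    (by simpa [← gagliardoSq_eq_lintegral_kernelMeasure] using hg)
  simp only [ENNReal.rpow_ofNat] at h1 h2
  have h3 := (ENNReal.Tendsto.const_mul h1 (a := ENNReal.ofReal K)
    (Or.inr ENNReal.ofReal_ne_top))
  rw [mul_zero] at h3
  refine ⟨_, by simpa only [add_zero] using h2.add h3, fun n => ?_⟩
  have hgd : gagliardoSq s (fun x => v n x - w x) + gagliardoSq s w ≤ c * gagliardoSq s (v n) +
      ∫⁻ z, (‖v n z.1 - v n z.2 - (w z.1 - w z.2)‖ₑ ^ 2 + ‖w z.1 - w z.2‖ₑ ^ 2 -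
        c * ‖v n z.1 - v n z.2‖ₑ ^ 2) ∂(kernelMeasure N s) := by
    simp only [gagliardoSq_eq_lintegral_kernelMeasure]
    have m1 : AEMeasurable (fun z : 𝔼 × 𝔼 => ‖v n z.1 - v n z.2‖ₑ ^ 2) (kernelMeasure N s) :=
      (aemeasurable_sub_kernelMeasure s (hv n)).enorm.pow_const 2
    have m2 : AEMeasurable (fun z : 𝔼 × 𝔼 => ‖w z.1 - w z.2‖ₑ ^ 2) (kernelMeasure N s) :=
      (aemeasurable_sub_kernelMeasure s hw).enorm.pow_const 2
    rw [← lintegral_add_right' _ m2, ← lintegral_const_mul' _ _ hcf,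
      ← lintegral_add_left' (m1.const_mul c)]
    refine lintegral_mono fun z => ?_
    have : v n z.1 - w z.1 - (v n z.2 - w z.2) = v n z.1 - v n z.2 - (w z.1 - w z.2) := by ring
    rw [this]
    exact le_add_tsub
  have hpot : (∫⁻ x, ENNReal.ofReal (W n x) * ‖v n x - w x‖ₑ ^ 2) +
      (∫⁻ x, ENNReal.ofReal (W n x) * ‖w x‖ₑ ^ 2) ≤
      c * (∫⁻ x, ENNReal.ofReal (W n x) * ‖v n x‖ₑ ^ 2) + ENNReal.ofReal K *
        ∫⁻ x, (‖v n x - w x‖ₑ ^ 2 + ‖w x‖ₑ ^ 2 - c * ‖v n x‖ₑ ^ 2) := by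
    have m0 : AEMeasurable fun x => ENNReal.ofReal (W n x) := (hW n).ennreal_ofReal.aemeasurable
    have m1 : AEMeasurable fun x => ENNReal.ofReal (W n x) * ‖v n x‖ₑ ^ 2 :=
      m0.mul ((hv n).enorm.pow_const 2)
    have m2 : AEMeasurable fun x => ENNReal.ofReal (W n x) * ‖w x‖ₑ ^ 2 :=
      m0.mul (hw.enorm.pow_const 2)
    rw [← lintegral_add_right' _ m2, ← lintegral_const_mul' _ _ hcf,
      ← lintegral_const_mul' _ _ ENNReal.ofReal_ne_top, ← lintegral_add_left' (m1.const_mul c)]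
    refine lintegral_mono fun x => ?_
    calc ENNReal.ofReal (W n x) * ‖v n x - w x‖ₑ ^ 2 + ENNReal.ofReal (W n x) * ‖w x‖ₑ ^ 2
        = ENNReal.ofReal (W n x) * (‖v n x - w x‖ₑ ^ 2 + ‖w x‖ₑ ^ 2) := by ring
      _ ≤ ENNReal.ofReal (W n x) * (c * ‖v n x‖ₑ ^ 2 +
          (‖v n x - w x‖ₑ ^ 2 + ‖w x‖ₑ ^ 2 - c * ‖v n x‖ₑ ^ 2)) := by
          exact mul_le_mul_right le_add_tsub _
      _ = c * (ENNReal.ofReal (W n x) * ‖v n x‖ₑ ^ 2) + ENNReal.ofReal (W n x) *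
          (‖v n x - w x‖ₑ ^ 2 + ‖w x‖ₑ ^ 2 - c * ‖v n x‖ₑ ^ 2) := by ring
      _ ≤ _ := add_le_add_right (mul_le_mul_left (ENNReal.ofReal_le_ofReal (hWK n x)) _) _
  simp only [energy]
  rw [add_add_add_comm]
  refine (add_le_add hgd hpot).trans (le_of_eq ?_)
  rw [add_add_add_comm, mul_add]

theorem gagliardoSq_le_of_tendsto_ae {s : ℝ} {v : ℕ → 𝔼 → ℝ} {w : 𝔼 → ℝ} {M : ℝ≥0∞}
    (hv : ∀ n, AEMeasurable (v n)) (hlim : ∀ᵐ x, Tendsto (fun n => v n x) atTop (𝓝 (w x)))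
    (hM : ∀ n, gagliardoSq s (v n) ≤ M) : gagliardoSq s w ≤ M := by
  rw [gagliardoSq_eq_lintegral_kernelMeasure]
  have hM' : ∀ n, ∫⁻ z, ‖v n z.1 - v n z.2‖ₑ ^ 2 ∂(kernelMeasure N s) ≤ M := fun n => by
    rw [← gagliardoSq_eq_lintegral_kernelMeasure]
    exact hM n
  have hm : ∀ n, AEMeasurable (fun z : 𝔼 × 𝔼 => ‖v n z.1 - v n z.2‖ₑ ^ 2) (kernelMeasure N s) :=
    fun n => (aemeasurable_sub_kernelMeasure s (hv n)).enorm.pow_const 2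
  have hl : ∀ᵐ z ∂(kernelMeasure N s), Tendsto (fun n => ‖v n z.1 - v n z.2‖ₑ ^ 2) atTop
      (𝓝 (‖w z.1 - w z.2‖ₑ ^ 2)) := by
    filter_upwards [ae_kernelMeasure_tendsto_sub s hlim] with z hz
    exact ((ENNReal.continuous_pow 2).tendsto _).comp hz.enorm
  exact lintegral_le_of_tendsto_ae hm hl (Frequently.of_forall hM')

theorem lintegral_rpow_le_of_tendsto_ae {v : ℕ → 𝔼 → ℝ} {w : 𝔼 → ℝ} {M : ℝ≥0∞} (p : ℝ)
    (hv : ∀ n, AEMeasurable (v n)) (hlim : ∀ᵐ x, Tendsto (fun n => v n x) atTop (𝓝 (w x)))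
    (hM : ∀ n, ∫⁻ x, ‖v n x‖ₑ ^ p ≤ M) : ∫⁻ x, ‖w x‖ₑ ^ p ≤ M :=
  lintegral_le_of_tendsto_ae (fun n => (hv n).enorm.pow_const p)
    (hlim.mono fun _ hx => tendsto_enorm_rpow_of_tendsto p hx) (Frequently.of_forall hM)

/-! ### A competitor of finite energy -/

/-- The integrand is `r^(1-2s)` near zero, integrable because `s < 1`, and `r^(-1-2s)` beyond one,
integrable because `s > 0`. -/
theorem integrableOn_rpow_mul_min_div {s : ℝ} (hs0 : 0 < s) (hs1 : s < 1) (hN : 0 < N) :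
    IntegrableOn (fun r : ℝ => r ^ (N - 1) • (min 1 (r ^ 2) / r ^ ((N : ℝ) + 2 * s)))
      (Set.Ioi 0) := by
  have hpow : ∀ r : ℝ, 0 < r → r ^ (N - 1) = r ^ ((N : ℝ) - 1) := fun r hr => by
    rw [← Real.rpow_natCast, Nat.cast_sub hN, Nat.cast_one]
  rw [← Set.Ioc_union_Ioi_eq_Ioi (zero_le_one (α := ℝ))]
  refine IntegrableOn.union ?_ ?_
  · have h1 : IntegrableOn (fun r : ℝ => r ^ (1 - 2 * s)) (Set.Ioc 0 1) :=
      (intervalIntegrable_iff_integrableOn_Ioc_of_le zero_le_one).1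
        (intervalIntegral.intervalIntegrable_rpow' (by linarith))
    refine h1.congr_fun (fun r hr => ?_) measurableSet_Ioc
    have hr0 := hr.1
    have : min 1 (r ^ 2) = r ^ (2 : ℝ) := by
      rw [Real.rpow_two]; exact min_eq_right (pow_le_one₀ hr0.le hr.2)
    beta_reduce
    rw [smul_eq_mul, hpow r hr0, this, mul_div_assoc', ← Real.rpow_add hr0, ← Real.rpow_sub hr0]
    congr 1
    ring
  · refine (integrableOn_Ioi_rpow_of_lt (a := -1 - 2 * s) (by linarith) zero_lt_one).congr_fun
      (fun r hr => ?_) measurableSet_Ioi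
    have hr1 : (1 : ℝ) < r := hr
    have hr0 : 0 < r := by linarith
    have : min 1 (r ^ 2) = (1 : ℝ) := min_eq_left (one_le_pow₀ hr1.le)
    beta_reduce
    rw [smul_eq_mul, hpow r hr0, this, mul_one_div, ← Real.rpow_sub hr0]
    congr 1
    ring

theorem lintegral_min_div_lt_top {s : ℝ} (hs0 : 0 < s) (hs1 : s < 1) (hN : 0 < N) :
    ∫⁻ x : 𝔼, ENNReal.ofReal (min 1 (‖x‖ ^ 2) / ‖x‖ ^ ((N : ℝ) + 2 * s)) < ∞ := by
  have : Nonempty (Fin N) := ⟨⟨0, hN⟩⟩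
  have h := (integrable_fun_norm_addHaar (volume : Measure 𝔼)
    (f := fun r : ℝ => min 1 (r ^ 2) / r ^ ((N : ℝ) + 2 * s))).2 (by
      rw [finrank_euclideanSpace_fin]
      exact integrableOn_rpow_mul_min_div hs0 hs1 hN)
  exact h.lintegral_lt_top

/-- The cone `x ↦ max (1 - |x|) 0`. -/
def coneFun (x : EuclideanSpace ℝ (Fin N)) : ℝ := max (1 - ‖x‖) 0

theorem continuous_coneFun : Continuous (coneFun : 𝔼 → ℝ) := by
  unfold coneFun; fun_prop

theorem abs_coneFun_sub_le (x y : 𝔼) : |coneFun x - coneFun y| ≤ ‖x - y‖ := by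
  have h := abs_max_sub_max_le_abs (1 - ‖x‖) (1 - ‖y‖) 0
  refine h.trans ?_
  have h2 : 1 - ‖x‖ - (1 - ‖y‖) = ‖y‖ - ‖x‖ := by ring
  rw [h2, norm_sub_rev x y]
  exact abs_norm_sub_norm_le y x

theorem coneFun_nonneg (x : 𝔼) : 0 ≤ coneFun x := le_max_right _ _

theorem coneFun_le_one (x : 𝔼) : coneFun x ≤ 1 :=
  max_le (by linarith [norm_nonneg x]) zero_le_one

theorem coneFun_eq_zero {x : 𝔼} (hx : x ∉ ball (0 : 𝔼) 1) : coneFun x = 0 := by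
  have : 1 ≤ ‖x‖ := by simpa using hx
  exact max_eq_right (by linarith)

theorem coneFun_pos {x : 𝔼} (hx : x ∈ ball (0 : 𝔼) 1) : 0 < coneFun x := by
  have : ‖x‖ < 1 := by simpa using hx
  exact lt_max_of_lt_left (by linarith)

theorem lintegral_coneFun_rpow_lt_top {p : ℝ} (hp : 0 < p) :
    ∫⁻ x : 𝔼, ‖coneFun x‖ₑ ^ p < ∞ := by
  calc ∫⁻ x : 𝔼, ‖coneFun x‖ₑ ^ p ≤ ∫⁻ x : 𝔼, (ball (0 : 𝔼) 1).indicator 1 x := by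
        refine lintegral_mono fun x => ?_
        by_cases hx : x ∈ ball (0 : 𝔼) 1
        · rw [Set.indicator_of_mem hx, Pi.one_apply]
          refine ENNReal.rpow_le_one ?_ hp.le
          rw [Real.enorm_of_nonneg (coneFun_nonneg x)]
          exact ENNReal.ofReal_le_one.2 (coneFun_le_one x)
        · simp [coneFun_eq_zero hx, hp]
    _ < ∞ := by
        rw [lintegral_indicator_one measurableSet_ball]
        exact measure_ball_lt_top

theorem lintegral_coneFun_rpow_pos {p : ℝ} (hp : 0 < p) :
    0 < ∫⁻ x : 𝔼, ‖coneFun x‖ₑ ^ p := by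
  rw [pos_iff_ne_zero]
  intro h
  have hm : Measurable fun x : 𝔼 => ‖coneFun x‖ₑ ^ p :=
    continuous_coneFun.measurable.enorm.pow_const p
  have h2 := (lintegral_eq_zero_iff hm).1 h
  have h3 : ∀ᵐ x : 𝔼, x ∉ ball (0 : 𝔼) 1 := by
    filter_upwards [h2] with x hx hx1
    simp only [Pi.zero_apply, ENNReal.rpow_eq_zero_iff] at hx
    rcases hx with hx | hx
    · exact (coneFun_pos hx1).ne' (by simpa using hx.1)
    · linarith [hx.2]
  have h4 : volume (ball (0 : 𝔼) 1) = 0 := by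
    rw [ae_iff] at h3
    simpa only [not_not, Set.ofPred_mem_eq] using h3
  exact (measure_ball_pos volume (0 : 𝔼) one_pos).ne' h4

/-- The cone is 1-Lipschitz with values in `[0, 1]`, and a pair contributes only if one of its
points lies in the unit ball. Fubini then separates the volume of that ball from the integral of the
truncated kernel. -/
theorem gagliardoSq_coneFun_lt_top {s : ℝ} (hs0 : 0 < s) (hs1 : s < 1) (hN : 0 < N) :
    gagliardoSq s (coneFun : 𝔼 → ℝ) < ∞ := by
  set κ : 𝔼 → ℝ≥0∞ := fun h =>
    ENNReal.ofReal (min 1 (‖h‖ ^ 2) / ‖h‖ ^ ((N : ℝ) + 2 * s)) with hκ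
  have hκm : Measurable κ := by fun_prop
  set b : 𝔼 → ℝ≥0∞ := (ball (0 : 𝔼) 1).indicator 1 with hb
  have hbm : Measurable b := measurable_one.indicator measurableSet_ball
  have hbi : ∫⁻ x, b x < ∞ := by
    rw [hb, lintegral_indicator_one measurableSet_ball]
    exact measure_ball_lt_top
  have hκi : ∫⁻ x, κ x < ∞ := lintegral_min_div_lt_top hs0 hs1 hN
  have hptw : ∀ z : 𝔼 × 𝔼, ENNReal.ofReal (|coneFun z.1 - coneFun z.2| ^ 2 /
      ‖z.1 - z.2‖ ^ ((N : ℝ) + 2 * s)) ≤ b z.1 * κ (z.1 - z.2) + b z.2 * κ (z.1 - z.2) := by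
    intro z
    rw [← add_mul]
    by_cases h : z.1 ∉ ball (0 : 𝔼) 1 ∧ z.2 ∉ ball (0 : 𝔼) 1
    · simp [coneFun_eq_zero h.1, coneFun_eq_zero h.2]
    · have h1 : 1 ≤ b z.1 + b z.2 := by
        by_cases hz : z.1 ∈ ball (0 : 𝔼) 1
        · have : b z.1 = 1 := Set.indicator_of_mem hz _
          rw [this]; exact le_self_add
        · have hz2 : z.2 ∈ ball (0 : 𝔼) 1 := by tauto
          have : b z.2 = 1 := Set.indicator_of_mem hz2 _
          rw [this]; exact le_add_self
      refine le_trans ?_ (le_mul_of_one_le_left' h1)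
      refine ENNReal.ofReal_le_ofReal ?_
      refine div_le_div_of_nonneg_right ?_ (by positivity)
      refine le_min ?_ (pow_le_pow_left₀ (abs_nonneg _) (abs_coneFun_sub_le _ _) 2)
      refine pow_le_one₀ (abs_nonneg _) (abs_le.2 ⟨?_, ?_⟩) <;>
      linarith [coneFun_nonneg z.1, coneFun_nonneg z.2, coneFun_le_one z.1, coneFun_le_one z.2]
  have hsub : Measurable fun z : 𝔼 × 𝔼 => κ (z.1 - z.2) :=
    hκm.comp (measurable_fst.sub measurable_snd)
  have m1 : Measurable fun z : 𝔼 × 𝔼 => b z.1 * κ (z.1 - z.2) :=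
    (hbm.comp measurable_fst).mul hsub
  have m2 : Measurable fun z : 𝔼 × 𝔼 => b z.2 * κ (z.1 - z.2) :=
    (hbm.comp measurable_snd).mul hsub
  have i1 : ∫⁻ z : 𝔼 × 𝔼, b z.1 * κ (z.1 - z.2) ∂(volume.prod volume) =
      (∫⁻ x, b x) * ∫⁻ x, κ x := by
    rw [lintegral_prod _ m1.aemeasurable, ← lintegral_mul_const _ hbm]
    refine lintegral_congr fun x => ?_
    have hm : Measurable fun y : 𝔼 => κ (x - y) := hκm.comp (measurable_const.sub measurable_id)
    change ∫⁻ y, b x * κ (x - y) = _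
    rw [lintegral_const_mul _ hm, lintegral_sub_left_eq_self κ x]
  have i2 : ∫⁻ z : 𝔼 × 𝔼, b z.2 * κ (z.1 - z.2) ∂(volume.prod volume) =
      (∫⁻ x, b x) * ∫⁻ x, κ x := by
    rw [lintegral_prod_symm _ m2.aemeasurable, ← lintegral_mul_const _ hbm]
    refine lintegral_congr fun x => ?_
    have hm : Measurable fun y : 𝔼 => κ (y - x) := hκm.comp (measurable_id.sub measurable_const)
    change ∫⁻ y, b x * κ (y - x) = _
    rw [lintegral_const_mul _ hm, lintegral_sub_right_eq_self κ x]
  calc gagliardoSq s (coneFun : 𝔼 → ℝ)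
      ≤ ∫⁻ z : 𝔼 × 𝔼, (b z.1 * κ (z.1 - z.2) + b z.2 * κ (z.1 - z.2)) ∂(volume.prod volume) :=
        lintegral_mono hptw
    _ = (∫⁻ x, b x) * (∫⁻ x, κ x) + (∫⁻ x, b x) * ∫⁻ x, κ x := by
        rw [lintegral_add_left m1, i1, i2]
    _ < ∞ := ENNReal.add_lt_top.2 ⟨ENNReal.mul_lt_top hbi hκi, ENNReal.mul_lt_top hbi hκi⟩

/-! ### Scaling and exclusion of dichotomy -/

theorem gagliardoSq_const_mul (s t : ℝ) (u : 𝔼 → ℝ) :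
    gagliardoSq s (fun x => t * u x) = ‖t‖ₑ ^ 2 * gagliardoSq s u := by
  simp only [gagliardoSq_eq_lintegral_kernelMeasure]
  rw [← lintegral_const_mul' _ _ (by simp)]
  refine lintegral_congr fun z => ?_
  rw [← mul_sub, enorm_mul, mul_pow]

theorem energy_const_mul (s t : ℝ) (V u : 𝔼 → ℝ) :
    energy s V (fun x => t * u x) = ‖t‖ₑ ^ 2 * energy s V u := by
  rw [energy, energy, gagliardoSq_const_mul, mul_add, ← lintegral_const_mul' _ _ (by simp)]
  congr 1
  refine lintegral_congr fun x => ?_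
  rw [enorm_mul]
  ring

theorem lintegral_rpow_const_mul {p : ℝ} (hp : 0 < p) (t : ℝ) (u : 𝔼 → ℝ) :
    ∫⁻ x, ‖t * u x‖ₑ ^ p = ‖t‖ₑ ^ p * ∫⁻ x, ‖u x‖ₑ ^ p := by
  rw [← lintegral_const_mul' _ _ (ENNReal.rpow_ne_top_of_nonneg hp.le enorm_ne_top)]
  refine lintegral_congr fun x => ?_
  rw [enorm_mul, ENNReal.mul_rpow_of_nonneg _ _ hp.le]

theorem exists_const_mul_lintegral_rpow_eq_one {p : ℝ} (hp : 0 < p) {u : 𝔼 → ℝ}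
    (h0 : ∫⁻ x, ‖u x‖ₑ ^ p ≠ 0) (hf : ∫⁻ x, ‖u x‖ₑ ^ p ≠ ∞) :
    ∃ t : ℝ, ‖t‖ₑ ^ 2 * (∫⁻ x, ‖u x‖ₑ ^ p) ^ (2 / p) = 1 ∧ ∫⁻ x, ‖t * u x‖ₑ ^ p = 1 := by
  set I := ∫⁻ x, ‖u x‖ₑ ^ p with hI
  have hIt : I ^ (-(1 / p)) ≠ ∞ := by
    rw [ENNReal.rpow_neg]
    refine ENNReal.inv_ne_top.2 fun h => h0 ?_
    exact (ENNReal.rpow_eq_zero_iff_of_pos (by positivity)).1 h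
  have ht : ‖(I ^ (-(1 / p))).toReal‖ₑ = I ^ (-(1 / p)) := by
    rw [Real.enorm_of_nonneg ENNReal.toReal_nonneg, ENNReal.ofReal_toReal hIt]
  refine ⟨(I ^ (-(1 / p))).toReal, ?_, ?_⟩
  · rw [ht, ← ENNReal.rpow_natCast, ← ENNReal.rpow_mul, ← ENNReal.rpow_add _ _ h0 hf]
    have : -(1 / p) * ((2 : ℕ) : ℝ) + 2 / p = 0 := by push_cast; ring
    rw [this, ENNReal.rpow_zero]
  · rw [lintegral_rpow_const_mul hp, ← hI, ht, ← ENNReal.rpow_mul]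
    have : -(1 / p) * p = -1 := by field_simp
    rw [this, ENNReal.rpow_neg_one, ENNReal.inv_mul_cancel h0 hf]

/-- Both numbers are at most one, where `t ≤ t^q`, strictly for `0 < t < 1`. An `a` below one would
contradict the two inequalities. -/
theorem ennreal_eq_one_of_rpow_add_rpow_le_one {a b : ℝ≥0∞} {q : ℝ} (hq0 : 0 < q) (hq1 : q < 1)
    (ha : a ≠ 0) (h : b ^ q + a ^ q ≤ 1) (h1 : 1 ≤ b + a) : a = 1 := by
  have le_one : ∀ t : ℝ≥0∞, t ^ q ≤ 1 → t ≤ 1 := fun t ht => by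
    by_contra! hc
    exact absurd ht (not_le.2 (ENNReal.one_lt_rpow hc hq0))
  have ha1 : a ≤ 1 := le_one a (le_add_self.trans h)
  have hb1 : b ≤ 1 := le_one b (le_self_add.trans h)
  refine le_antisymm ha1 (not_lt.1 fun hlt => ?_)
  have i1 : a < a ^ q := by
    have := ENNReal.rpow_lt_rpow_of_exponent_gt (pos_iff_ne_zero.2 ha) hlt hq1
    rwa [ENNReal.rpow_one] at this
  have i2 : b ≤ b ^ q := by
    have := ENNReal.rpow_le_rpow_of_exponent_ge hb1 hq1.le
    rwa [ENNReal.rpow_one] at this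
  have i3 : b + a < b ^ q + a ^ q :=
    ENNReal.add_lt_add_of_le_of_lt (ne_top_of_le_ne_top (by norm_num) hb1) i2 i1
  exact absurd (h1.trans_lt i3) (not_lt.2 h)

theorem ennreal_le_of_forall_one_lt_le_mul_add {x a b : ℝ≥0∞} (hb : b ≠ ∞)
    (h : ∀ c : ℝ≥0∞, 1 < c → c ≠ ∞ → x ≤ c * b + a) : x ≤ b + a := by
  have : (𝓝[>] (1 : ℝ≥0∞)).NeBot := nhdsGT_neBot_of_exists_gt ⟨2, by norm_num⟩
  have h1 : Tendsto (fun c : ℝ≥0∞ => c * b + a) (𝓝[>] 1) (𝓝 (1 * b + a)) :=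
    (ENNReal.Tendsto.mul_const (tendsto_id.mono_left nhdsWithin_le_nhds)
      (Or.inr hb)).add_const a
  rw [one_mul] at h1
  refine ge_of_tendsto h1 ?_
  have h2 : ∀ᶠ c : ℝ≥0∞ in 𝓝[>] 1, c < ∞ :=
    (eventually_lt_nhds (show (1 : ℝ≥0∞) < ∞ by norm_num)).filter_mono nhdsWithin_le_nhds
  filter_upwards [h2, self_mem_nhdsWithin] with c hc hc1
  exact h c hc1 hc.ne

theorem mul_rpow_le_energy {s p : ℝ} (hp : 0 < p) {V : 𝔼 → ℝ} {S : ℝ≥0∞}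
    (hS : ∀ u : 𝔼 → ℝ, AEStronglyMeasurable u → ∫⁻ x, ‖u x‖ₑ ^ p = 1 → S ≤ energy s V u)
    {u : 𝔼 → ℝ} (hu : AEStronglyMeasurable u) (hf : ∫⁻ x, ‖u x‖ₑ ^ p ≠ ∞) :
    S * (∫⁻ x, ‖u x‖ₑ ^ p) ^ (2 / p) ≤ energy s V u := by
  rcases eq_or_ne (∫⁻ x, ‖u x‖ₑ ^ p) 0 with h0 | h0
  · rw [h0, ENNReal.zero_rpow_of_pos (by positivity), mul_zero]
    exact zero_le
  obtain ⟨t, ht, ht1⟩ := exists_const_mul_lintegral_rpow_eq_one hp h0 hf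
  have h := hS (fun x => t * u x) (hu.const_mul t) ht1
  rw [energy_const_mul] at h
  calc S * (∫⁻ x, ‖u x‖ₑ ^ p) ^ (2 / p)
      ≤ ‖t‖ₑ ^ 2 * energy s V u * (∫⁻ x, ‖u x‖ₑ ^ p) ^ (2 / p) := by gcongr
    _ = (‖t‖ₑ ^ 2 * (∫⁻ x, ‖u x‖ₑ ^ p) ^ (2 / p)) * energy s V u := by ring
    _ = energy s V u := by rw [ht, one_mul]

/-- The seminorm does not see the potential and, being finite, can be moved across. Fatou handles
the potential term. -/
theorem energy_le_of_tendsto {s : ℝ} {W : ℕ → 𝔼 → ℝ} {W' w : 𝔼 → ℝ}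
    (hW : ∀ n, Measurable (W n)) (hlim : ∀ x, Tendsto (fun n => W n x) atTop (𝓝 (W' x)))
    (hw : AEMeasurable w) {e : ℝ≥0∞} (hg : gagliardoSq s w ≠ ∞)
    (h : ∃ᶠ n in atTop, energy s (W n) w ≤ e) : energy s W' w ≤ e := by
  have h1 : ∫⁻ x, ENNReal.ofReal (W' x) * ‖w x‖ₑ ^ 2 ≤ e - gagliardoSq s w := by
    refine lintegral_le_of_tendsto_ae (F := fun n x => ENNReal.ofReal (W n x) * ‖w x‖ₑ ^ 2)
      (fun n => (hW n).ennreal_ofReal.aemeasurable.mul (hw.enorm.pow_const 2))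
      (Eventually.of_forall fun x => ?_) (h.mono fun n hn => ?_)
    · exact ENNReal.Tendsto.mul_const (ENNReal.tendsto_ofReal (hlim x)) (Or.inr (by simp))
    · exact ENNReal.le_sub_of_add_le_left hg hn
  have h2 : gagliardoSq s w ≤ e := by
    obtain ⟨n, hn⟩ := h.exists
    exact le_self_add.trans hn
  calc energy s W' w ≤ gagliardoSq s w + (e - gagliardoSq s w) := add_le_add_right h1 _
    _ = e := add_tsub_cancel_of_le h2

theorem lintegral_rpow_sub_ne_top {p : ℝ} (hp : 1 ≤ p) {u w : 𝔼 → ℝ} (hu : AEStronglyMeasurable u)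
    (hu1 : ∫⁻ x, ‖u x‖ₑ ^ p ≠ ∞) (hw1 : ∫⁻ x, ‖w x‖ₑ ^ p ≠ ∞) :
    ∫⁻ x, ‖u x - w x‖ₑ ^ p ≠ ∞ := by
  have hpp : 0 ≤ p := by linarith
  have hD : (2 : ℝ≥0∞) ^ (p - 1) ≠ ∞ := ENNReal.rpow_ne_top_of_nonneg (by linarith) (by norm_num)
  refine ne_top_of_le_ne_top (b := 2 ^ (p - 1) * ((∫⁻ x, ‖u x‖ₑ ^ p) + ∫⁻ x, ‖w x‖ₑ ^ p))
    (ENNReal.mul_ne_top hD (ENNReal.add_ne_top.2 ⟨hu1, hw1⟩)) ?_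
  rw [← lintegral_add_left' (hu.enorm.pow_const p), ← lintegral_const_mul' _ _ hD]
  refine lintegral_mono fun x => ?_
  exact (ENNReal.rpow_le_rpow enorm_sub_le hpp).trans
    (ENNReal.rpow_add_le_mul_rpow_add_rpow _ _ hp)

theorem lintegral_rpow_eq_one_of_minimizing {s p K : ℝ} (hp : 2 < p) {S : ℝ≥0∞} (hS0 : S ≠ 0)
    (hSf : S ≠ ∞) {v : ℕ → 𝔼 → ℝ} {w : 𝔼 → ℝ} {W : ℕ → 𝔼 → ℝ}
    (hW : ∀ n, Measurable (W n)) (hWK : ∀ n x, W n x ≤ K)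
    (hS : ∀ n (u : 𝔼 → ℝ), AEStronglyMeasurable u → ∫⁻ x, ‖u x‖ₑ ^ p ≠ ∞ →
      S * (∫⁻ x, ‖u x‖ₑ ^ p) ^ (2 / p) ≤ energy s (W n) u)
    (hE : Tendsto (fun n => energy s (W n) (v n)) atTop (𝓝 S))
    (hv : ∀ n, AEStronglyMeasurable (v n)) (hv1 : ∀ n, ∫⁻ x, ‖v n x‖ₑ ^ p = 1)
    (hw : AEStronglyMeasurable w)
    (hlim : ∀ᵐ x, Tendsto (fun n => v n x) atTop (𝓝 (w x)))
    (hw2 : ∫⁻ x, ‖w x‖ₑ ^ 2 ≠ ∞) (hg : gagliardoSq s w ≠ ∞)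
    (hw0 : ∫⁻ x, ‖w x‖ₑ ^ p ≠ 0) : ∫⁻ x, ‖w x‖ₑ ^ p = 1 := by
  have hpp : 0 < p := by linarith
  have hwp : ∫⁻ x, ‖w x‖ₑ ^ p ≤ 1 := lintegral_rpow_le_of_tendsto_ae p
    (fun n => (hv n).aemeasurable) hlim (fun n => (hv1 n).le)
  have hwf : ∫⁻ x, ‖w x‖ₑ ^ p ≠ ∞ := ne_top_of_le_ne_top (by norm_num) hwp
  set a := ∫⁻ x, ‖w x‖ₑ ^ p with ha
  set b : ℕ → ℝ≥0∞ := fun n => ∫⁻ x, ‖v n x - w x‖ₑ ^ p with hb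
  have hbf : ∀ n, b n ≠ ∞ := fun n =>
    lintegral_rpow_sub_ne_top (by linarith) (hv n) (by rw [hv1 n]; norm_num) hwf
  -- Compactness of `[0, ∞]` gives a limit point without a prior bound; finiteness of `β` follows
  -- from the energy splitting.
  obtain ⟨β, φ, hφ, hβ⟩ := CompactSpace.tendsto_subseq b
  have hsplit : ∀ c : ℝ≥0∞, 1 < c → c ≠ ∞ → β ^ (2 / p) + a ^ (2 / p) ≤ c * 1 + 0 := by
    intro c hc hcf
    obtain ⟨R, hR, hle⟩ := exists_energy_sub_add_energy_le hW hWK (fun n => (hv n).aemeasurable)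
      hw.aemeasurable hlim hw2 hg hc hcf
    have h1 : Tendsto (fun n => c * energy s (W (φ n)) (v (φ n)) + R (φ n)) atTop
        (𝓝 (c * S + 0)) :=
      (ENNReal.Tendsto.const_mul (hE.comp hφ.tendsto_atTop) (Or.inr hcf)).add
        (hR.comp hφ.tendsto_atTop)
    have h2 : Tendsto (fun n => S * b (φ n) ^ (2 / p) + S * a ^ (2 / p)) atTop
        (𝓝 (S * β ^ (2 / p) + S * a ^ (2 / p))) :=
      (ENNReal.Tendsto.const_mul (((ENNReal.continuous_rpow_const (y := 2 / p)).tendsto β).comp hβ)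
        (Or.inr hSf)).add_const _
    have h3 := le_of_tendsto_of_tendsto' h2 h1 fun n =>
      (add_le_add (hS (φ n) _ ((hv _).sub hw) (hbf _)) (hS (φ n) w hw hwf)).trans (hle (φ n))
    rw [← mul_add, add_zero, mul_comm c S] at h3
    rw [mul_one, add_zero]
    exact (ENNReal.mul_le_mul_iff_right hS0 hSf).1 h3
  have h1 : β ^ (2 / p) + a ^ (2 / p) ≤ 1 := by
    have := ennreal_le_of_forall_one_lt_le_mul_add (by norm_num) hsplit
    simpa using this
  have hβf : β ≠ ∞ := by
    rintro rfl
    rw [ENNReal.top_rpow_of_pos (by positivity), top_add] at h1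
    simp at h1
  have h2 : 1 ≤ β + a := by
    refine ennreal_le_of_forall_one_lt_le_mul_add hβf fun c hc hcf => ?_
    have hR := tendsto_lintegral_brezisLieb_upper hpp hc hcf (fun n => (hv n).aemeasurable)
      hw.aemeasurable hlim hwf
    have h3 : Tendsto (fun n => c * b (φ n) + a +
        ∫⁻ x, (‖v (φ n) x‖ₑ ^ p - (c * ‖v (φ n) x - w x‖ₑ ^ p + ‖w x‖ₑ ^ p))) atTop
        (𝓝 (c * β + a + 0)) :=
      ((ENNReal.Tendsto.const_mul hβ (Or.inr hcf)).add_const a).add (hR.comp hφ.tendsto_atTop)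
    rw [add_zero] at h3
    refine ge_of_tendsto' h3 fun n => ?_
    have m1 : AEMeasurable fun x => ‖v (φ n) x - w x‖ₑ ^ p :=
      ((hv (φ n)).sub hw).enorm.pow_const p
    have m2 : AEMeasurable fun x => ‖w x‖ₑ ^ p := hw.enorm.pow_const p
    have m3 : AEMeasurable fun x => c * ‖v (φ n) x - w x‖ₑ ^ p + ‖w x‖ₑ ^ p :=
      (m1.const_mul c).add m2
    rw [← hv1 (φ n), hb, ha, ← lintegral_const_mul' _ _ hcf, ← lintegral_add_right' _ m2,
      ← lintegral_add_left' m3]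
    exact lintegral_mono fun x => le_add_tsub
  refine ennreal_eq_one_of_rpow_add_rpow_le_one (q := 2 / p) (by positivity) ?_ hw0 h1 h2
  rw [div_lt_one hpp]
  exact hp

theorem eventually_energy_le_of_minimizing {s K : ℝ} {S : ℝ≥0∞}
    (hSf : S ≠ ∞) {v : ℕ → 𝔼 → ℝ} {w : 𝔼 → ℝ} {W : ℕ → 𝔼 → ℝ}
    (hW : ∀ n, Measurable (W n)) (hWK : ∀ n x, W n x ≤ K)
    (hE : Tendsto (fun n => energy s (W n) (v n)) atTop (𝓝 S))
    (hv : ∀ n, AEStronglyMeasurable (v n)) (hw : AEStronglyMeasurable w)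
    (hlim : ∀ᵐ x, Tendsto (fun n => v n x) atTop (𝓝 (w x)))
    (hw2 : ∫⁻ x, ‖w x‖ₑ ^ 2 ≠ ∞) (hg : gagliardoSq s w ≠ ∞) {e : ℝ≥0∞} (he : S < e) :
    ∀ᶠ n in atTop, energy s (W n) w ≤ e := by
  obtain ⟨c, hc, hcf, hce⟩ : ∃ c : ℝ≥0∞, 1 < c ∧ c ≠ ∞ ∧ c * S < e := by
    by_contra! hcon
    have := ennreal_le_of_forall_one_lt_le_mul_add (a := 0) hSf
      (fun c h1 h2 => by rw [add_zero]; exact hcon c h1 h2)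
    rw [add_zero] at this
    exact absurd he (not_lt.2 this)
  obtain ⟨R, hR, hle⟩ := exists_energy_sub_add_energy_le hW hWK (fun n => (hv n).aemeasurable)
    hw.aemeasurable hlim hw2 hg hc hcf
  have h1 : Tendsto (fun n => c * energy s (W n) (v n) + R n) atTop (𝓝 (c * S + 0)) :=
    (ENNReal.Tendsto.const_mul hE (Or.inr hcf)).add hR
  rw [add_zero] at h1
  filter_upwards [h1.eventually (gt_mem_nhds hce)] with n hn
  exact (le_add_self.trans (hle n)).trans hn.le

/-! ### Nontrivial limit, recentering and existence of a minimizer -/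

theorem lintegral_sq_le_of_energy_le {s V₀ B : ℝ} {V u : 𝔼 → ℝ} (hV₀ : 0 < V₀)
    (hV : ∀ x, V₀ ≤ V x) (h : energy s V u ≤ ENNReal.ofReal B) :
    ∫⁻ x, ‖u x‖ₑ ^ 2 ≤ ENNReal.ofReal (B / V₀) := by
  have h1 : ENNReal.ofReal V₀ * ∫⁻ x, ‖u x‖ₑ ^ 2 ≤ ENNReal.ofReal B := by
    rw [← lintegral_const_mul' _ _ ENNReal.ofReal_ne_top]
    refine le_trans (lintegral_mono fun x => ?_) (le_add_self.trans h)
    exact mul_le_mul_left (ENNReal.ofReal_le_ofReal (hV x)) _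
  rw [ENNReal.ofReal_div_of_pos hV₀, ENNReal.le_div_iff_mul_le (Or.inl (by simpa using hV₀))
    (Or.inl ENNReal.ofReal_ne_top), mul_comm]
  exact h1

theorem memLp_two_of_lintegral_sq_lt_top {α : Type*} [MeasurableSpace α] {μ : Measure α}
    {u : α → ℝ} (hu : AEStronglyMeasurable u μ) (h : ∫⁻ x, ‖u x‖ₑ ^ 2 ∂μ < ∞) : MemLp u 2 μ := by
  refine ⟨hu, ?_⟩
  rw [← sq_eLpNorm_two] at h
  simpa using h

/-- If `w` vanished, the `L²` bound would upgrade convergence on the ball to `L¹`, and the averages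
at the origin would tend to zero. -/
theorem lintegral_rpow_ne_zero_of_ballAvg {p r δ M : ℝ} (hr : 0 < r) (hδ : 0 < δ) (hp : 0 < p)
    {v : ℕ → 𝔼 → ℝ} {w : 𝔼 → ℝ} (hv : ∀ n, AEStronglyMeasurable (v n))
    (hM : ∀ n, ∫⁻ x, ‖v n x‖ₑ ^ 2 ≤ ENNReal.ofReal M) (hw : AEStronglyMeasurable w)
    (hlim : ∀ᵐ x, Tendsto (fun n => v n x) atTop (𝓝 (w x)))
    (havg : ∀ n, δ ≤ |ballAvg r (v n) 0|) : ∫⁻ x, ‖w x‖ₑ ^ p ≠ 0 := by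
  intro h0
  have hw0 : ∀ᵐ x, w x = 0 := by
    have := (lintegral_eq_zero_iff' (hw.enorm.pow_const p)).1 h0
    filter_upwards [this] with x hx
    have h2 : ‖w x‖ₑ ^ p = 0 := hx
    simpa using (ENNReal.rpow_eq_zero_iff_of_pos hp).1 h2
  set B : Set 𝔼 := ball 0 r with hB
  have hB0 : volume B ≠ 0 := (measure_ball_pos volume _ hr).ne'
  have hBf : volume B ≠ ∞ := measure_ball_lt_top.ne
  have : IsFiniteMeasure (volume.restrict B) := ⟨by simpa using hBf.lt_top⟩
  have hl : ∀ᵐ x ∂(volume.restrict B), Tendsto (fun n => v n x) atTop (𝓝 0) := by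
    refine ae_restrict_of_ae ?_
    filter_upwards [hlim, hw0] with x hx hx0
    rwa [hx0] at hx
  obtain ⟨n, hn⟩ := (eventually_lintegral_enorm_le_of_tendsto_zero (μ := volume.restrict B)
    (M := ENNReal.ofReal M) ENNReal.ofReal_ne_top (fun n => (hv n).aemeasurable.restrict) hl
    (fun n => (setLIntegral_le_lintegral _ _).trans (hM n))
    (β := ENNReal.ofReal (δ / 2) * volume B)
    (mul_ne_zero (by simpa using hδ) hB0)).exists
  have h1 : ‖ballAvg r (v n) 0‖ₑ ≤ (volume B)⁻¹ * ∫⁻ x in B, ‖v n x‖ₑ := by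
    rw [ballAvg, average_eq', Measure.restrict_apply_univ]
    refine (enorm_integral_le_lintegral_enorm _).trans (le_of_eq ?_)
    rw [lintegral_smul_measure, smul_eq_mul]
  have h2 : ENNReal.ofReal δ ≤ ENNReal.ofReal (δ / 2) := by
    calc ENNReal.ofReal δ ≤ ‖ballAvg r (v n) 0‖ₑ := by
          rw [← ofReal_norm, Real.norm_eq_abs]
          exact ENNReal.ofReal_le_ofReal (havg n)
      _ ≤ (volume B)⁻¹ * (ENNReal.ofReal (δ / 2) * volume B) := h1.trans (mul_le_mul_right hn _)
      _ = ENNReal.ofReal (δ / 2) * ((volume B)⁻¹ * volume B) := by ring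
      _ = ENNReal.ofReal (δ / 2) := by rw [ENNReal.inv_mul_cancel hB0 hBf, mul_one]
  rw [ENNReal.ofReal_le_ofReal_iff (by positivity)] at h2
  linarith

theorem exists_translate_energy_le {s K : ℝ} {V w : 𝔼 → ℝ} {S : ℝ≥0∞} (hVc : Continuous V)
    (hVK : ∀ x, V x ≤ K) (hV : Tendsto V (cocompact 𝔼) (𝓝 K)) (hw : AEStronglyMeasurable w)
    (hg : gagliardoSq s w ≠ ∞) {y : ℕ → 𝔼}
    (h : ∀ e, S < e → ∀ᶠ n in atTop, energy s (fun x => V (x + y n)) w ≤ e) :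
    ∃ z : 𝔼, energy s V (fun x => w (x + z)) ≤ S := by
  by_cases hy : ∃ R, ∃ᶠ n in atTop, y n ∈ closedBall (0 : 𝔼) R
  · obtain ⟨R, hR⟩ := hy
    obtain ⟨a, -, φ, hφ, ha⟩ := tendsto_subseq_of_frequently_bounded isBounded_closedBall hR
    refine ⟨-a, le_of_forall_gt_imp_ge_of_dense fun e he => ?_⟩
    have h1 : energy s (fun x => V (x + a)) w ≤ e := by
      refine energy_le_of_tendsto (W := fun n x => V (x + y (φ n)))
        (fun n => (hVc.comp (continuous_add_const _)).measurable) (fun x => ?_)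
        hw.aemeasurable hg (hφ.tendsto_atTop.eventually (h e he)).frequently
      exact (hVc.tendsto _).comp (tendsto_const_nhds.add ha)
    rw [← energy_translate s _ w (-a)] at h1
    simpa using h1
  · push Not at hy
    refine ⟨0, le_of_forall_gt_imp_ge_of_dense fun e he => ?_⟩
    have hcob : ∀ x, Tendsto (fun n => x + y n) atTop (cocompact 𝔼) := fun x => by
      rw [← cobounded_eq_cocompact, ← tendsto_norm_atTop_iff_cobounded]
      refine tendsto_atTop.2 fun b => ?_
      filter_upwards [hy (b + ‖x‖)] with n hn
      have h1 : b + ‖x‖ < ‖y n‖ := by simpa using hn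
      have h2 := norm_sub_le (x + y n) x
      rw [add_sub_cancel_left] at h2
      linarith
    have h1 : energy s (fun _ => K) w ≤ e :=
      energy_le_of_tendsto (W := fun n x => V (x + y n))
        (fun n => (hVc.comp (continuous_add_const _)).measurable)
        (fun x => hV.comp (hcob x)) hw.aemeasurable hg (h e he).frequently
    refine le_trans ?_ h1
    simp only [add_zero]
    refine add_le_add_right (lintegral_mono fun x => ?_) _
    exact mul_le_mul_left (ENNReal.ofReal_le_ofReal (hVK x)) _

/-- Energies tending to zero would force small `L²` norms, hence small averages at the fixed scale
`r`, against the lower bound `δ`. Positivity of `S` is what allows it to be cancelled in the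
splitting. -/
theorem ne_zero_of_tendsto_energy {s p V₀ : ℝ} (hs : 0 < s) (hp : 2 < p)
    (hps : (N : ℝ) * (1 - 2 / p) < 2 * s) {V : 𝔼 → ℝ} (hV₀ : 0 < V₀) (hV : ∀ x, V₀ ≤ V x)
    {S : ℝ≥0∞} {u : ℕ → 𝔼 → ℝ} (hu : ∀ n, AEStronglyMeasurable (u n))
    (hu1 : ∀ n, ∫⁻ x, ‖u n x‖ₑ ^ p = 1)
    (hE : Tendsto (fun n => energy s V (u n)) atTop (𝓝 S)) : S ≠ 0 := by
  rintro rfl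
  obtain ⟨r, δ, hr, hδ, H⟩ := exists_le_abs_ballAvg (N := N) hs hp hps (max 1 (1 / V₀))
  set c : ℝ≥0∞ := (volume (ball (0 : 𝔼) r))⁻¹ with hc
  have hcf : c ≠ ∞ := ENNReal.inv_ne_top.2 (measure_ball_pos volume _ hr).ne'
  have hl : Tendsto (fun t : ℝ => c * ENNReal.ofReal (t / V₀)) (𝓝[>] 0) (𝓝 0) := by
    have h1 : Tendsto (fun t : ℝ => t / V₀) (𝓝[>] 0) (𝓝 (0 / V₀)) :=
      (tendsto_id.mono_left nhdsWithin_le_nhds).div_const V₀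
    have h2 := ENNReal.Tendsto.const_mul (ENNReal.tendsto_ofReal h1) (a := c) (Or.inr hcf)
    simpa using h2
  have hδ2 : (0 : ℝ≥0∞) < ENNReal.ofReal δ ^ 2 := by
    have : 0 < ENNReal.ofReal δ := by simpa using hδ
    positivity
  obtain ⟨t, ⟨ht, ht1⟩, ht0⟩ := (((hl.eventually (gt_mem_nhds hδ2)).and
    ((eventually_le_nhds (show (0 : ℝ) < 1 by norm_num)).filter_mono nhdsWithin_le_nhds)).and
    self_mem_nhdsWithin).exists
  have ht0 : 0 < t := ht0
  obtain ⟨n, hn⟩ := (hE.eventually (ge_mem_nhds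
    (show (0 : ℝ≥0∞) < ENNReal.ofReal t by simpa using ht0))).exists
  have i1 := lintegral_sq_le_of_energy_le hV₀ hV hn
  have hmem := memLp_two_of_lintegral_sq_lt_top (hu n) (i1.trans_lt ENNReal.ofReal_lt_top)
  have i2 : ∫⁻ x, ‖u n x‖ₑ ^ 2 ≤ ENNReal.ofReal (max 1 (1 / V₀)) := by
    refine i1.trans (ENNReal.ofReal_le_ofReal ((?_ : t / V₀ ≤ 1 / V₀).trans (le_max_right _ _)))
    gcongr
  have i3 : gagliardoSq s (u n) ≤ ENNReal.ofReal (max 1 (1 / V₀)) :=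
    (le_self_add.trans hn).trans (ENNReal.ofReal_le_ofReal (ht1.trans (le_max_left _ _)))
  obtain ⟨x, hx⟩ := H (u n) hmem i2 i3 (hu1 n)
  have i4 : ENNReal.ofReal δ ^ 2 ≤ c * ENNReal.ofReal (t / V₀) := by
    calc ENNReal.ofReal δ ^ 2 ≤ ‖ballAvg r (u n) x‖ₑ ^ 2 := by
          rw [← ofReal_norm, Real.norm_eq_abs]
          exact pow_le_pow_left' (ENNReal.ofReal_le_ofReal hx) 2
      _ ≤ _ := (enorm_ballAvg_sq_le hr hmem x).trans (mul_le_mul_right i1 _)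
  exact absurd ht (not_lt.2 i4)

theorem exists_energy_minimizer {s p V₀ K : ℝ} (hs : 0 < s) (hp : 2 < p)
    (hps : (N : ℝ) * (1 - 2 / p) < 2 * s) {V : 𝔼 → ℝ} (hVc : Continuous V) (hV₀ : 0 < V₀)
    (hVV₀ : ∀ x, V₀ ≤ V x) (hVK : ∀ x, V x ≤ K) (hV : Tendsto V (cocompact 𝔼) (𝓝 K))
    {S : ℝ≥0∞} (hSf : S ≠ ∞)
    (hS : ∀ u : 𝔼 → ℝ, AEStronglyMeasurable u → ∫⁻ x, ‖u x‖ₑ ^ p = 1 → S ≤ energy s V u)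
    {u : ℕ → 𝔼 → ℝ} (hu : ∀ n, AEStronglyMeasurable (u n))
    (hu1 : ∀ n, ∫⁻ x, ‖u n x‖ₑ ^ p = 1)
    (hE : Tendsto (fun n => energy s V (u n)) atTop (𝓝 S)) :
    ∃ w : 𝔼 → ℝ, AEStronglyMeasurable w ∧ ∫⁻ x, ‖w x‖ₑ ^ p = 1 ∧ energy s V w ≤ S := by
  have hpp : 0 < p := by linarith
  have hS0 : S ≠ 0 := ne_zero_of_tendsto_energy hs hp hps hV₀ hVV₀ hu hu1 hE
  obtain ⟨n₀, hn₀⟩ : ∃ n₀, ∀ n, n₀ ≤ n → energy s V (u n) ≤ S + 1 :=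
    eventually_atTop.1 (hE.eventually (ge_mem_nhds (ENNReal.lt_add_right hSf one_ne_zero)))
  have hB : ∀ n, energy s V (u (n + n₀)) ≤ ENNReal.ofReal (S + 1).toReal := fun n => by
    rw [ENNReal.ofReal_toReal (ENNReal.add_ne_top.2 ⟨hSf, ENNReal.one_ne_top⟩)]
    exact hn₀ _ (Nat.le_add_left _ _)
  set B := (S + 1).toReal with hBdef
  set M := max B (B / V₀) with hMdef
  have hu2 : ∀ n, ∫⁻ x, ‖u (n + n₀) x‖ₑ ^ 2 ≤ ENNReal.ofReal M := fun n =>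
    (lintegral_sq_le_of_energy_le hV₀ hVV₀ (hB n)).trans
      (ENNReal.ofReal_le_ofReal (le_max_right _ _))
  have hug : ∀ n, gagliardoSq s (u (n + n₀)) ≤ ENNReal.ofReal M := fun n =>
    (le_self_add.trans (hB n)).trans (ENNReal.ofReal_le_ofReal (le_max_left _ _))
  obtain ⟨r, δ, hr, hδ, H⟩ := exists_le_abs_ballAvg (N := N) hs hp hps M
  choose y hy using fun n => H (u (n + n₀)) (memLp_two_of_lintegral_sq_lt_top (hu _)
    ((hu2 n).trans_lt ENNReal.ofReal_lt_top)) (hu2 n) (hug n) (hu1 _)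
  set v : ℕ → 𝔼 → ℝ := fun n x => u (n + n₀) (x + y n) with hv
  have hvm : ∀ n, AEStronglyMeasurable (v n) := fun n => aestronglyMeasurable_translate (hu _) _
  have hv2 : ∀ n, ∫⁻ x, ‖v n x‖ₑ ^ 2 ≤ ENNReal.ofReal M := fun n =>
    (lintegral_translate (fun x => ‖u (n + n₀) x‖ₑ ^ 2) (y n)).trans_le (hu2 n)
  have hv1 : ∀ n, ∫⁻ x, ‖v n x‖ₑ ^ p = 1 := fun n =>
    (lintegral_translate (fun x => ‖u (n + n₀) x‖ₑ ^ p) (y n)).trans (hu1 _)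
  have hvg : ∀ n, gagliardoSq s (v n) ≤ ENNReal.ofReal M := fun n =>
    (gagliardoSq_translate s (u (n + n₀)) (y n)).trans_le (hug n)
  have hvE : ∀ n, energy s (fun x => V (x + y n)) (v n) = energy s V (u (n + n₀)) := fun n =>
    energy_translate s V _ _
  obtain ⟨φ, w, hφ, hw, hlim⟩ := exists_subseq_tendsto_ae hs
    (fun n => memLp_two_of_lintegral_sq_lt_top (hvm n)
      ((hv2 n).trans_lt ENNReal.ofReal_lt_top)) hv2 hvg
  have hw2 : ∫⁻ x, ‖w x‖ₑ ^ 2 ≠ ∞ := by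
    have := lintegral_rpow_le_of_tendsto_ae 2 (fun n => (hvm (φ n)).aemeasurable) hlim
      (M := ENNReal.ofReal M) (fun n => by simpa using hv2 (φ n))
    simp only [ENNReal.rpow_ofNat] at this
    exact ne_top_of_le_ne_top ENNReal.ofReal_ne_top this
  have hwg : gagliardoSq s w ≠ ∞ := ne_top_of_le_ne_top ENNReal.ofReal_ne_top
    (gagliardoSq_le_of_tendsto_ae (fun n => (hvm (φ n)).aemeasurable) hlim (fun n => hvg _))
  have hw0 : ∫⁻ x, ‖w x‖ₑ ^ p ≠ 0 := lintegral_rpow_ne_zero_of_ballAvg hr hδ hpp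
    (fun n => hvm (φ n)) (fun n => hv2 (φ n)) hw hlim (fun n => by
      have h1 : ballAvg r (v (φ n)) 0 = ballAvg r (u (φ n + n₀)) (y (φ n)) := by
        rw [hv, ballAvg_translate, zero_add]
      rw [h1]
      exact hy (φ n))
  have hWm : ∀ n, Measurable fun x => V (x + y (φ n)) := fun n =>
    (hVc.comp (continuous_add_const _)).measurable
  have hWE : Tendsto (fun n => energy s (fun x => V (x + y (φ n))) (v (φ n))) atTop (𝓝 S) := by
    simp only [hvE]
    exact ((tendsto_add_atTop_iff_nat n₀).2 hE).comp hφ.tendsto_atTop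
  have hw1 : ∫⁻ x, ‖w x‖ₑ ^ p = 1 := by
    refine lintegral_rpow_eq_one_of_minimizing hp hS0 hSf hWm (fun n x => hVK _) ?_ hWE
      (fun n => hvm _) (fun n => hv1 _) hw hlim hw2 hwg hw0
    -- The lower bound for `V` passes to each translated potential by translating the competitor
    -- back.
    intro n f hf hff
    refine mul_rpow_le_energy hpp (fun g hg hg1 => ?_) hf hff
    have h1 := hS (fun x => g (x + -y (φ n))) (aestronglyMeasurable_translate hg _)
      ((lintegral_translate (fun x => ‖g x‖ₑ ^ p) (-y (φ n))).trans hg1)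
    rw [← energy_translate s V _ (y (φ n))] at h1
    simpa using h1
  obtain ⟨z, hz⟩ := exists_translate_energy_le (y := fun n => y (φ n)) hVc hVK hV hw hwg
    (fun e he => eventually_energy_le_of_minimizing hSf hWm (fun n x => hVK _) hWE
      (fun n => hvm _) hw hlim hw2 hwg he)
  exact ⟨fun x => w (x + z), aestronglyMeasurable_translate hw z,
    (lintegral_translate (fun x => ‖w x‖ₑ ^ p) z).trans hw1, hz⟩

/-! ### From extended to real-valued energies -/

/-- A lower limit equal to the supremum is a genuine limit, since the supremum bounds `V` from
above. -/
theorem ConditionV1.tendsto_cocompact {V : 𝔼 → ℝ} (hV : ConditionV1 V) :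
    Tendsto V (cocompact 𝔼) (𝓝 (⨆ x, V x)) := by
  obtain ⟨V₀, -, hV₀⟩ := hV.lower
  refine tendsto_order.2 ⟨fun b hb => ?_, fun b hb => ?_⟩
  · rw [hV.sup_eq_liminf] at hb
    exact eventually_lt_of_lt_liminf hb ⟨V₀, by simpa using Eventually.of_forall hV₀⟩
  · exact Eventually.of_forall fun x => (le_ciSup hV.bddAbove x).trans_lt hb

/-- Since `V > 0`, the weighted measure and Lebesgue measure have the same null sets, so
measurability agrees for both. -/
theorem mem_unitSphere_iff {s p : ℝ} (hp : 0 < p) {V u : 𝔼 → ℝ} (hV : ConditionV1 V) :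
    u ∈ unitSphere s p V ↔
      AEStronglyMeasurable u ∧ energy s V u < ∞ ∧ ∫⁻ x, ‖u x‖ₑ ^ p = 1 := by
  obtain ⟨V₀, hV₀, hVV₀⟩ := hV.lower
  have hm : Measurable fun x => ENNReal.ofReal (V x) :=
    hV.contDiff.continuous.measurable.ennreal_ofReal
  have hac : (volume : Measure 𝔼) ≪ volume.withDensity fun x => ENNReal.ofReal (V x) :=
    withDensity_absolutelyContinuous' hm.aemeasurable (Eventually.of_forall fun x => by
      simpa using hV₀.trans_le (hVV₀ x))
  have h1 : AEStronglyMeasurable u (volume.withDensity fun x => ENNReal.ofReal (V x)) ↔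
      AEStronglyMeasurable u volume :=
    ⟨fun h => h.mono_ac hac, fun h => h.mono_ac (withDensity_absolutelyContinuous _ _)⟩
  have h2 : eLpNorm u 2 (volume.withDensity fun x => ENNReal.ofReal (V x)) < ∞ ↔
      ∫⁻ x, ENNReal.ofReal (V x) * ‖u x‖ₑ ^ 2 < ∞ := by
    have h3 := sq_eLpNorm_two (μ := volume.withDensity fun x => ENNReal.ofReal (V x)) u
    rw [lintegral_withDensity_eq_lintegral_mul_non_measurable _ hm
      (Eventually.of_forall fun _ => ENNReal.ofReal_lt_top)] at h3
    simp only [Pi.mul_apply] at h3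
    rw [← h3]
    simp
  have h4 : eLpNorm u (ENNReal.ofReal p) volume = 1 ↔ ∫⁻ x, ‖u x‖ₑ ^ p = 1 := by
    rw [eLpNorm_eq_lintegral_rpow_enorm_toReal (by simpa using hp) ENNReal.ofReal_ne_top,
      ENNReal.toReal_ofReal hp.le]
    refine ⟨fun h => ?_, fun h => by rw [h, ENNReal.one_rpow]⟩
    have := congrArg (fun t => t ^ p) h
    simpa [← ENNReal.rpow_mul, hp.ne'] using this
  rw [unitSphere, HsV, energy, ENNReal.add_lt_top, Set.mem_ofPred_eq, Set.mem_ofPred_eq, MemLp,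
    h1, h2, h4]
  tauto

theorem normHsV_sq {s : ℝ} {V u : 𝔼 → ℝ} (hV : ConditionV1 V) (hu : AEStronglyMeasurable u)
    (hE : energy s V u < ∞) : normHsV s V u ^ 2 = (energy s V u).toReal := by
  obtain ⟨V₀, hV₀, hVV₀⟩ := hV.lower
  have hV0 : ∀ x, 0 ≤ V x := fun x => hV₀.le.trans (hVV₀ x)
  have h := ENNReal.add_lt_top.1 hE
  have h1 : ∫ x, V x * u x ^ 2 = (∫⁻ x, ENNReal.ofReal (V x) * ‖u x‖ₑ ^ 2).toReal := by
    rw [integral_eq_lintegral_of_nonneg_ae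
      (Eventually.of_forall fun x => mul_nonneg (hV0 x) (sq_nonneg _))
      (hV.contDiff.continuous.aestronglyMeasurable.mul (hu.pow 2))]
    congr 1
    refine lintegral_congr fun x => ?_
    rw [ENNReal.ofReal_mul (hV0 x), ← ofReal_norm, ← ENNReal.ofReal_pow (norm_nonneg _),
      Real.norm_eq_abs, sq_abs]
  rw [normHsV, Real.sq_sqrt (add_nonneg ENNReal.toReal_nonneg
    (integral_nonneg fun x => mul_nonneg (hV0 x) (sq_nonneg _))), h1, energy,
    ENNReal.toReal_add h.1.ne h.2.ne]

theorem unitSphere_nonempty {s p : ℝ} (hs0 : 0 < s) (hs1 : s < 1) (hN : 0 < N) (hp : 0 < p)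
    {V : 𝔼 → ℝ} (hV : ConditionV1 V) : (unitSphere s p V).Nonempty := by
  obtain ⟨t, -, ht⟩ := exists_const_mul_lintegral_rpow_eq_one (N := N) hp
    (lintegral_coneFun_rpow_pos hp).ne' (lintegral_coneFun_rpow_lt_top hp).ne
  refine ⟨fun x => t * coneFun x, (mem_unitSphere_iff hp hV).2 ⟨?_, ?_, ht⟩⟩
  · exact (continuous_const.mul continuous_coneFun).aestronglyMeasurable
  · rw [energy_const_mul]
    refine ENNReal.mul_lt_top (by simp) (ENNReal.add_lt_top.2
      ⟨gagliardoSq_coneFun_lt_top hs0 hs1 hN, ?_⟩)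
    have h2 := lintegral_coneFun_rpow_lt_top (N := N) two_pos
    simp only [ENNReal.rpow_ofNat] at h2
    calc ∫⁻ x, ENNReal.ofReal (V x) * ‖coneFun x‖ₑ ^ 2
        ≤ ∫⁻ x : 𝔼, ENNReal.ofReal (⨆ x, V x) * ‖coneFun x‖ₑ ^ 2 := lintegral_mono fun x =>
          mul_le_mul_left (ENNReal.ofReal_le_ofReal (le_ciSup hV.bddAbove x)) _
      _ = ENNReal.ofReal (⨆ x, V x) * ∫⁻ x : 𝔼, ‖coneFun x‖ₑ ^ 2 :=
          lintegral_const_mul' _ _ ENNReal.ofReal_ne_top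
      _ < ∞ := ENNReal.mul_lt_top ENNReal.ofReal_lt_top h2

theorem exists_mem_unitSphere_eq_infLevel {s p : ℝ} (hs0 : 0 < s) (hs1 : s < 1) (hN : 0 < N)
    (hp : 2 < p) (hps : (N : ℝ) * (1 - 2 / p) < 2 * s) {V : 𝔼 → ℝ} (hV : ConditionV1 V) :
    ∃ w ∈ unitSphere s p V, normHsV s V w ^ 2 = infLevel s p V := by
  have hpp : 0 < p := by linarith
  obtain ⟨V₀, hV₀, hVV₀⟩ := hV.lower
  have hne : ((fun u => normHsV s V u ^ 2) '' unitSphere s p V).Nonempty :=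
    (unitSphere_nonempty hs0 hs1 hN hpp hV).image _
  have hbdd : BddBelow ((fun u => normHsV s V u ^ 2) '' unitSphere s p V) := by
    refine ⟨0, ?_⟩
    rintro _ ⟨u, -, rfl⟩
    exact sq_nonneg _
  have hinf0 : 0 ≤ infLevel s p V := le_csInf hne (by rintro _ ⟨u, -, rfl⟩; exact sq_nonneg _)
  obtain ⟨a, -, ha, hau⟩ := exists_seq_tendsto_sInf hne hbdd
  choose u hu hua using hau
  have hu' := fun n => (mem_unitSphere_iff hpp hV).1 (hu n)
  have hE : Tendsto (fun n => energy s V (u n)) atTop (𝓝 (ENNReal.ofReal (infLevel s p V))) := by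
    refine (ENNReal.tendsto_ofReal ha).congr fun n => ?_
    rw [← hua n]
    simp only
    rw [normHsV_sq hV (hu' n).1 (hu' n).2.1, ENNReal.ofReal_toReal (hu' n).2.1.ne]
  have hS : ∀ f : 𝔼 → ℝ, AEStronglyMeasurable f → ∫⁻ x, ‖f x‖ₑ ^ p = 1 →
      ENNReal.ofReal (infLevel s p V) ≤ energy s V f := fun f hf hf1 => by
    rcases eq_or_ne (energy s V f) ∞ with h | h
    · rw [h]; exact le_top
    refine ENNReal.ofReal_le_of_le_toReal ?_
    rw [← normHsV_sq hV hf h.lt_top]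
    exact csInf_le hbdd ⟨f, (mem_unitSphere_iff hpp hV).2 ⟨hf, h.lt_top, hf1⟩, rfl⟩
  obtain ⟨w, hw, hw1, hwE⟩ := exists_energy_minimizer hs0 hp hps hV.contDiff.continuous hV₀ hVV₀
    (fun x => le_ciSup hV.bddAbove x) hV.tendsto_cocompact ENNReal.ofReal_ne_top hS
    (fun n => (hu' n).1) (fun n => (hu' n).2.2) hE
  have hwf : energy s V w < ∞ := hwE.trans_lt ENNReal.ofReal_lt_top
  refine ⟨w, (mem_unitSphere_iff hpp hV).2 ⟨hw, hwf, hw1⟩, ?_⟩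
  rw [normHsV_sq hV hw hwf, le_antisymm hwE (hS w hw hw1), ENNReal.toReal_ofReal hinf0]

end FracSchrodinger

end

theorem mainTheorem9 (N : ℕ) (s : ℝ) (hs0 : 0 < s) (hs1 : s < 1) (hN : 2 * s < (N : ℝ))
    (ε : ℝ) (hε0 : 0 < ε) (hε1 : ε < FracSchrodinger.critExp N s - 2)
    (V : EuclideanSpace ℝ (Fin N) → ℝ) (hV : FracSchrodinger.ConditionV1 V) :
    ∃ w ∈ FracSchrodinger.unitSphere s (FracSchrodinger.critExp N s - ε) V,
      FracSchrodinger.normHsV s V w ^ 2 =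
        FracSchrodinger.infLevel s (FracSchrodinger.critExp N s - ε) V := by
  have hN0 : 0 < N := by
    have : (0 : ℝ) < N := by linarith
    exact_mod_cast this
  have hp : 2 < FracSchrodinger.critExp N s - ε := by linarith
  refine FracSchrodinger.exists_mem_unitSphere_eq_infLevel hs0 hs1 hN0 hp ?_ hV
  have hd : 0 < (N : ℝ) - 2 * s := by linarith
  -- Being below the critical exponent is rewritten as `N (1 - 2/p) < 2s`, the form in which the
  -- dyadic series converges.
  have h1 : (FracSchrodinger.critExp N s - ε) * ((N : ℝ) - 2 * s) < 2 * N := by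
    rw [← lt_div_iff₀ hd]
    have : FracSchrodinger.critExp N s = 2 * (N : ℝ) / ((N : ℝ) - 2 * s) := rfl
    linarith
  set p := FracSchrodinger.critExp N s - ε
  have h2 : (N : ℝ) - 2 * s < 2 * N / p := by
    rw [lt_div_iff₀ (by linarith), mul_comm]
    exact h1
  have h3 : (N : ℝ) * (1 - 2 / p) = N - 2 * N / p := by ring
  linarith
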